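/- Let $\mathbb H$ be the quaternions, $\mathbb S=\{J\in\mathbb H: J^2=-1\}$, and $n\ge 0$ an integer. Products over index sets are ordered: for $K=\{k_1<\dots<k_p\}\subseteq\{1,\dots,n\}$ and $a_1,\dots,a_n\in\mathbb H$ put $a_K=a_{k_1}\cdots a_{k_p}$ and $a_\emptyset=1$. **Slice functions.** Let $D\subseteq\mathbb C^n$ be invariant under $z\mapsto\overline z^h=(z_1,\dots,\overline{z_h},\dots,z_n)$ for every $h$. Put $$\Omega_D=\{(\alpha_1+J_1\beta_1,\dots,\alpha_n+J_n\beta_n): J_1,\dots,J_n\in\mathbb S,\ (\alpha_1+i\beta_1,\dots,\alpha_n+i\beta_n)\in D\}.$$ A set $\Omega\subseteq\mathbb H^n$ is axially symmetric if $\Omega=\Omega_D$ for such a $D$. Let $(e_K)_{K\subseteq\{1,\dots,n\}}$ be a basis of $\mathbb R^{2^n}$. A map $F=\sum_K e_KF_K:D\to\mathbb H\otimes\mathbb R^{2^n}$, with components $F_K:D\to\mathbb H$, is a stem function if, for all $z\in D$, $K$ and $h$, $F_K(\overline z^h)=F_K(z)$ when $h\notin K$ and $F_K(\overline z^h)=-F_K(z)$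 when $h\in K$. It induces the (left) slice function $f:\Omega_D\to\mathbb H$ given by $$f(\alpha_1+J_1\beta_1,\dots,\alpha_n+J_n\beta_n)=\sum_K J_KF_K(\alpha_1+i\beta_1,\dots,\alpha_n+i\beta_n).$$ **Slice-regular functions.** Define $\mathcal J_h$ on $\mathbb H\otimes\mathbb R^{2^n}$ by $\mathcal J_h(e_Ka)=e_{K\cup\{h\}}a$ if $h\notin K$ and $\mathcal J_h(e_Ka)=-e_{K\setminus\{h\}}a$ if $h\in K$ ($a\in\mathbb H$). For $\Omega_D$ open (equivalently, $D$ open), a slice function on $\Omega_D$ is slice-regular if it is induced by a stem function $F$ of class $C^1$ on $D$ with $$\tfrac12\Big(\frac{\partial F}{\partial\alpha_h}+\mathcal J_h\frac{\partial F}{\partial\beta_h}\Big)=0\quad\text{on } D\text{ for } h=1,\dots,n.$$ **Wirtinger operators.** Let $\mathbb R_\bullet=\{x\in\mathbb H^n: x_k\in\mathbb R\text{ for some }k\}$. Write $x_m=x_{m,0}+e_1x_{m,1}+e_2x_{m,2}+e_3x_{m,3}$ with $(e_1,e_2,e_3)=(i,j,k)$ the imaginary units of $\mathbb H$, and $\mathrm{Im}(x_m)=x_m-x_{m,0}$.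 Put $$\overline\vartheta_{x_m}=\frac12\Big(\frac{\partial}{\partial x_{m,0}}-\mathrm{Im}(x_m)^{-1}\sum_{i=1}^3x_{m,i}\frac{\partial}{\partial x_{m,i}}\Big),$$ $$\Gamma_{x_m}=-\frac12\sum_{i,j=1}^3e_ie_j\Big(x_{m,i}\frac{\partial}{\partial x_{m,j}}-x_{m,j}\frac{\partial}{\partial x_{m,i}}\Big).$$ For an $\mathbb H$-valued $f$ of class $C^n$ on an open subset of $\mathbb H^n\setminus\mathbb R_\bullet$ define recursively $\Gamma^0_\emptyset(f)=f$ and, for $1\le m\le n$ and $K\subseteq\{1,\dots,m\}$, $$\Gamma^m_K(f)=(2\,\mathrm{Im}(x_m))^{-1}\,\Gamma_{x_m}\big(x_m^{\mathbf 1_K(m)}\,\Gamma^{m-1}_{K\setminus\{m\}}(f)\big),$$ where $\mathbf 1_K(m)=1$ if $m\in K$ and $0$ otherwise. The conjugate Wirtinger operators are, for $1\le m\le n$, $$\overline\theta_m(f)=\sum_{K\subseteq\{1,\dots,m-1\}}(-\overline x)_{\{1,\dots,m-1\}\setminus K}\ \overline\vartheta_{x_m}\Gamma^{m-1}_K(f),$$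 where $(-\overline x)_H$ is the ordered product of the quaternions $-\overline{x_k}$, $k\in H$. **Theorem.** Let $\Omega\subseteq\mathbb H^n$ be an axially symmetric open set, and let $f:\Omega\to\mathbb H$ be a slice function that is continuous on $\Omega$ and of class $C^n$ on $\Omega\setminus\mathbb R_\bullet$. Then $f$ is slice-regular on $\Omega$ if and only if $\overline\theta_m(f)=0$ on $\Omega\setminus\mathbb R_\bullet$ for every $m\in\{1,\dots,n\}$. -/

import Mathlib

open scoped Quaternion ContDiff

noncomputable section

namespace SliceSeveral

/-- The product `a_{k₁} * a_{k₂} * ⋯ * a_{k_p}` for `K = {k₁ < k₂ < ⋯ < k_p}`, and `1` for `K = ∅`. -/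
def orderedProd {n : ℕ} (a : Fin n → ℍ[ℝ]) (K : Finset (Fin n)) : ℍ[ℝ] :=
  ((K.sort (· ≤ ·)).map a).prod

/-! ### Axially symmetric sets, stem functions, slice functions -/

/-- The sphere of quaternionic imaginary units. -/
def imagUnits : Set ℍ[ℝ] := {J | J * J = -1}

/-- The point `(α₁ + J₁ β₁, …, αₙ + Jₙ βₙ)` for `z = (α₁ + i β₁, …, αₙ + i βₙ)`. -/
def slicePoint {n : ℕ} (J : Fin n → ℍ[ℝ]) (z : Fin n → ℂ) : Fin n → ℍ[ℝ] :=
  fun h => (((z h).re : ℝ) : ℍ[ℝ]) + J h * (((z h).im : ℝ) : ℍ[ℝ])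

/-- The point `z̄ʰ`: the `h`-th coordinate of `z` is conjugated. -/
def conjAt {n : ℕ} (h : Fin n) (z : Fin n → ℂ) : Fin n → ℂ :=
  Function.update z h (starRingEnd ℂ (z h))

/-- `D` is invariant under each of the `n` complex conjugations. -/
def ConjInvariant {n : ℕ} (D : Set (Fin n → ℂ)) : Prop :=
  ∀ z ∈ D, ∀ h : Fin n, conjAt h z ∈ D

/-- The set `Ω_D ⊆ ℍⁿ` associated with `D ⊆ ℂⁿ`. -/
def circularization {n : ℕ} (D : Set (Fin n → ℂ)) : Set (Fin n → ℍ[ℝ]) :=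
  {x | ∃ z ∈ D, ∃ J : Fin n → ℍ[ℝ], (∀ h, J h ∈ imagUnits) ∧ x = slicePoint J z}

/-- `Ω = Ω_D` for some conjugation invariant `D ⊆ ℂⁿ`. -/
def IsAxiallySymmetric {n : ℕ} (Ω : Set (Fin n → ℍ[ℝ])) : Prop :=
  ∃ D : Set (Fin n → ℂ), ConjInvariant D ∧ Ω = circularization D

/-- The real vector space `ℍ ⊗ ℝ^(2ⁿ)`; the family `(a_K)` stands for `∑_K e_K a_K`. -/
abbrev StemSpace (n : ℕ) : Type := Finset (Fin n) → ℍ[ℝ]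

/-- `F = ∑_K e_K F_K` is a stem function on `D`. -/
def IsStem {n : ℕ} (D : Set (Fin n → ℂ)) (F : (Fin n → ℂ) → StemSpace n) : Prop :=
  ∀ z ∈ D, ∀ (K : Finset (Fin n)) (h : Fin n),
    F (conjAt h z) K = if h ∈ K then -F z K else F z K

/-- `f` coincides on `Ω_D` with the function `x ↦ ∑_K J_K F_K(z)` induced by `F`. -/
def Induces {n : ℕ} (D : Set (Fin n → ℂ)) (F : (Fin n → ℂ) → StemSpace n)
    (f : (Fin n → ℍ[ℝ]) → ℍ[ℝ]) : Prop :=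
  ∀ z ∈ D, ∀ J : Fin n → ℍ[ℝ], (∀ h, J h ∈ imagUnits) →
    f (slicePoint J z) = ∑ K : Finset (Fin n), orderedProd J K * F z K

/-- `f` is a (left) slice function on `Ω`. -/
def IsSlice {n : ℕ} (Ω : Set (Fin n → ℍ[ℝ])) (f : (Fin n → ℍ[ℝ]) → ℍ[ℝ]) : Prop :=
  ∃ (D : Set (Fin n → ℂ)) (F : (Fin n → ℂ) → StemSpace n),
    ConjInvariant D ∧ Ω = circularization D ∧ IsStem D F ∧ Induces D F f

/-! ### Slice-regular functions -/

/-- The complex structure `𝒥_h` on `ℍ ⊗ ℝ^(2ⁿ)`, given on the basis by `𝒥_h e_K = e_(K ∪ {h})` if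
`h ∉ K` and `𝒥_h e_K = -e_(K \ {h})` if `h ∈ K`; here it is written in components. -/
def complexStructure {n : ℕ} (h : Fin n) (v : StemSpace n) : StemSpace n :=
  fun K => if h ∈ K then v (K.erase h) else -v (insert h K)

/-- The Cauchy-Riemann operator `∂̄_h F = ½ (∂F/∂α_h + 𝒥_h (∂F/∂β_h))`. -/
def stemDbar {n : ℕ} (h : Fin n) (F : (Fin n → ℂ) → StemSpace n) (z : Fin n → ℂ) : StemSpace n :=
  (1 / 2 : ℝ) • (fderiv ℝ F z (Pi.single h 1)
    + complexStructure h (fderiv ℝ F z (Pi.single h Complex.I)))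

/-- `f` is a slice-regular function on `Ω`: it is induced by a `C¹` stem function that is
holomorphic with respect to `𝒥_1, …, 𝒥_n`. -/
def IsSliceRegular {n : ℕ} (Ω : Set (Fin n → ℍ[ℝ])) (f : (Fin n → ℍ[ℝ]) → ℍ[ℝ]) : Prop :=
  ∃ (D : Set (Fin n → ℂ)) (F : (Fin n → ℂ) → StemSpace n),
    IsOpen D ∧ ConjInvariant D ∧ Ω = circularization D ∧ IsStem D F ∧ Induces D F f ∧
      ContDiffOn ℝ 1 F D ∧ ∀ h : Fin n, ∀ z ∈ D, stemDbar h F z = 0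

/-! ### Differential operators on functions of `n` quaternionic variables -/

/-- The set `ℝ_•` of the points of `ℍⁿ` with at least one real coordinate. -/
def realLocus (n : ℕ) : Set (Fin n → ℍ[ℝ]) := {x | ∃ k : Fin n, ∃ r : ℝ, x k = (r : ℍ[ℝ])}

/-- The imaginary units `i`, `j`, `k`. -/
def unitVec : Fin 3 → ℍ[ℝ] := ![⟨0, 1, 0, 0⟩, ⟨0, 0, 1, 0⟩, ⟨0, 0, 0, 1⟩]

/-- The real coordinates of a quaternion along `i`, `j`, `k`. -/
def imCoord (q : ℍ[ℝ]) : Fin 3 → ℝ := ![q.imI, q.imJ, q.imK]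

/-- The partial derivative of `g` at `x` in the direction `e ∈ ℍ` of the `m`-th variable. -/
def partialAt {n : ℕ} (m : Fin n) (e : ℍ[ℝ]) (g : (Fin n → ℍ[ℝ]) → ℍ[ℝ])
    (x : Fin n → ℍ[ℝ]) : ℍ[ℝ] :=
  fderiv ℝ g x (Pi.single m e)

/-- `∂̄_{x_m} g = ½ (∂g/∂x_{m,0} - Im(x_m)⁻¹ ∑ᵢ x_{m,i} ∂g/∂x_{m,i})`. -/
def globalDbar {n : ℕ} (m : Fin n) (g : (Fin n → ℍ[ℝ]) → ℍ[ℝ]) (x : Fin n → ℍ[ℝ]) : ℍ[ℝ] :=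
  (1 / 2 : ℝ) • (partialAt m 1 g x
    - ((x m).im)⁻¹ * ∑ i : Fin 3, imCoord (x m) i • partialAt m (unitVec i) g x)

/-- `L^m_{ij} g = x_{m,i} ∂g/∂x_{m,j} - x_{m,j} ∂g/∂x_{m,i}`. -/
def tangentialOp {n : ℕ} (m : Fin n) (i j : Fin 3) (g : (Fin n → ℍ[ℝ]) → ℍ[ℝ])
    (x : Fin n → ℍ[ℝ]) : ℍ[ℝ] :=
  imCoord (x m) i • partialAt m (unitVec j) g x - imCoord (x m) j • partialAt m (unitVec i) g x

/-- The spherical Dirac operator `Γ_{x_m} = -½ ∑_{i,j} e_i e_j L^m_{ij}`. -/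
def sphericalDirac {n : ℕ} (m : Fin n) (g : (Fin n → ℍ[ℝ]) → ℍ[ℝ]) (x : Fin n → ℍ[ℝ]) : ℍ[ℝ] :=
  -((1 / 2 : ℝ) • ∑ i : Fin 3, ∑ j : Fin 3, unitVec i * unitVec j * tangentialOp m i j g x)

/-- The functions `Γ^m_K(f)` for `0 ≤ m ≤ n` and `K` a set of the first `m` indices. The variables
are indexed by `0, …, n - 1`, so the step from `m` to `m + 1` uses the variable with index `m`. -/
def gammaIter {n : ℕ} (f : (Fin n → ℍ[ℝ]) → ℍ[ℝ]) (m : Fin (n + 1)) :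
    Finset (Fin n) → (Fin n → ℍ[ℝ]) → ℍ[ℝ] :=
  Fin.induction (motive := fun _ => Finset (Fin n) → (Fin n → ℍ[ℝ]) → ℍ[ℝ])
    (fun _ => f)
    (fun i prev K x => (2 * (x i).im)⁻¹ *
      sphericalDirac i (fun y => y i ^ (if i ∈ K then 1 else 0) * prev (K.erase i) y) x)
    m

/-- The conjugate Wirtinger operator `θ̄_m`; the indices before `m` form `Finset.Iio m`, and the
complement of `K` is taken there. -/
def wirtingerBar {n : ℕ} (m : Fin n) (f : (Fin n → ℍ[ℝ]) → ℍ[ℝ]) (x : Fin n → ℍ[ℝ]) : ℍ[ℝ] :=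
  ∑ K ∈ (Finset.Iio m).powerset,
    orderedProd (fun k => -star (x k)) (Finset.Iio m \ K)
      * globalDbar m (gammaIter f m.castSucc K) x

end SliceSeveral

end

noncomputable section

namespace SliceSeveral

section


variable {n : ℕ}

/-! ### Ordered products -/

/-! On a slice, `f` is `∑ J_L F_L(z)`. Write `x_i = α + J β`. If a function is affine in the `i`-th
unit, say `A + J_i B`, then `(2 Im x_i)⁻¹ Γ_{x_i}` returns `β⁻¹ B`; multiplying by `x_i` beforehand
gives `A + (α/β) B` instead (`inv_mul_sphericalDirac`). By induction `Γ^m_K(f)` is a real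
combination of the `F_L` in which the first `m` units no longer appear (`gammaIter_slicePoint`). The
next unit then stands leftmost, so left multiplication by it realises `𝒥` despite noncommutativity,
and the operator `∂̄` in the next variable acts on `F` as the Cauchy-Riemann operator. The factors
`-x̄_k` restore the lost units, because `β⁻¹(-x̄) + α/β = J`. Hence each conjugate Wirtinger
operator of `f` is the slice function induced by `∂̄_m F` (`wirtingerBar_slicePoint`), which settles
one implication.

Conversely, a stem vector inducing zero for all choices of units is zero (`stemSpace_eq_zero`), so
`∂̄_m F = 0` where no coordinate is real. What remains is regularity across the real coordinates.
Restricted to the slice of the unit `i`, `f` is continuous and, off those coordinates, separately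
holomorphic for left multiplication by `i`. Morera's theorem removes the real axes
(`contDiffOn_one_of_separately`), so the restriction is `C¹`. The stem function is recovered
linearly from this one slice (`stem_eq_sum_conjOn`), hence is `C¹` too, and `∂̄_m F = 0` extends by
density. -/

@[simp] lemma orderedProd_empty (a : Fin n → ℍ[ℝ]) : orderedProd a ∅ = 1 := by
  simp [orderedProd]

@[simp] lemma orderedProd_singleton (a : Fin n → ℍ[ℝ]) (k : Fin n) :
    orderedProd a {k} = a k := by
  simp [orderedProd]

lemma orderedProd_union (a : Fin n → ℍ[ℝ]) {A B : Finset (Fin n)}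
    (h : ∀ x ∈ A, ∀ y ∈ B, x < y) :
    orderedProd a (A ∪ B) = orderedProd a A * orderedProd a B := by
  have hdisj : Disjoint A B :=
    Finset.disjoint_left.2 fun x hA hB => lt_irrefl _ (h x hA x hB)
  have key : (A ∪ B).sort (· ≤ ·) = A.sort (· ≤ ·) ++ B.sort (· ≤ ·) := by
    apply List.Perm.eq_of_pairwise' (r := (· ≤ ·))
    · exact Finset.pairwise_sort _ _
    · rw [List.pairwise_append]
      refine ⟨Finset.pairwise_sort _ _, Finset.pairwise_sort _ _, fun x hx y hy => ?_⟩
      exact (h x ((Finset.mem_sort _).1 hx) y ((Finset.mem_sort _).1 hy)).le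
    · rw [List.perm_ext_iff_of_nodup (Finset.sort_nodup _ _)]
      · intro x; simp
      · refine List.Nodup.append (Finset.sort_nodup _ _) (Finset.sort_nodup _ _) ?_
        intro x hx hy
        exact Finset.disjoint_left.1 hdisj ((Finset.mem_sort _).1 hx) ((Finset.mem_sort _).1 hy)
  simp [orderedProd, key]

lemma orderedProd_insert_min (a : Fin n → ℍ[ℝ]) {A : Finset (Fin n)} {k : Fin n}
    (h : ∀ x ∈ A, k < x) : orderedProd a (insert k A) = a k * orderedProd a A := by
  rw [Finset.insert_eq, orderedProd_union a (by simpa using h), orderedProd_singleton]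

lemma orderedProd_insert_max (a : Fin n → ℍ[ℝ]) {A : Finset (Fin n)} {k : Fin n}
    (h : ∀ x ∈ A, x < k) : orderedProd a (insert k A) = orderedProd a A * a k := by
  rw [Finset.insert_eq, Finset.union_comm, orderedProd_union a (by simpa using h),
    orderedProd_singleton]

lemma orderedProd_congr {a b : Fin n → ℍ[ℝ]} {A : Finset (Fin n)} (h : ∀ k ∈ A, a k = b k) :
    orderedProd a A = orderedProd b A := by
  unfold orderedProd
  congr 1
  exact List.map_congr_left fun k hk => h k ((Finset.mem_sort _).1 hk)

lemma orderedProd_smul_const (s : Fin n → ℝ) (q : ℍ[ℝ]) (A : Finset (Fin n)) :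
    orderedProd (fun k => s k • q) A = (∏ k ∈ A, s k) • q ^ A.card := by
  induction A using Finset.induction_on_max with
  | empty => simp
  | insert k A h ih =>
    have hk : k ∉ A := fun hk => lt_irrefl _ (h k hk)
    rw [orderedProd_insert_max _ h, ih, Finset.prod_insert hk, Finset.card_insert_of_notMem hk,
      pow_succ, smul_mul_smul_comm, mul_comm]

/-- The indices of `L` that are at least `j`. -/
def upperPart (j : ℕ) (L : Finset (Fin n)) : Finset (Fin n) := L.filter fun k => j ≤ k.val

/-- The indices of `L` that are less than `j`. -/
def lowerPart (j : ℕ) (L : Finset (Fin n)) : Finset (Fin n) := L.filter fun k => k.val < j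

lemma upperPart_zero (L : Finset (Fin n)) : upperPart 0 L = L := by simp [upperPart]

lemma orderedProd_lowerPart_mul_upperPart (a : Fin n → ℍ[ℝ]) (j : ℕ) (L : Finset (Fin n)) :
    orderedProd a (lowerPart j L) * orderedProd a (upperPart j L) = orderedProd a L := by
  rw [← orderedProd_union]
  · congr 1
    ext k
    simp only [lowerPart, upperPart, Finset.mem_union, Finset.mem_filter]
    by_cases h : k.val < j
    · simp [h]
    · simp [h, not_lt.1 h]
  · intro x hx y hy
    simp only [lowerPart, upperPart, Finset.mem_filter] at hx hy
    exact Fin.lt_def.2 (by omega)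

/-- Isolates the leftmost factor, the one that the operators in the variable `i` see. -/
lemma orderedProd_upperPart (a : Fin n → ℍ[ℝ]) (i : Fin n) (L : Finset (Fin n)) :
    orderedProd a (upperPart i L) =
      (if i ∈ L then a i else 1) * orderedProd a (upperPart (i + 1) L) := by
  split_ifs with h
  · rw [← orderedProd_insert_min]
    · congr 1
      ext k
      simp only [upperPart, Finset.mem_insert, Finset.mem_filter, Fin.ext_iff]
      constructor
      · rintro ⟨hk, h2⟩
        by_cases hki : k.val = i.val
        · exact Or.inl hki
        · exact Or.inr ⟨hk, by omega⟩
      · rintro (hk | hk)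
        · rw [Fin.ext hk]; exact ⟨h, le_rfl⟩
        · exact ⟨hk.1, by omega⟩
    · intro x hx
      simp only [upperPart, Finset.mem_filter] at hx
      exact Fin.lt_def.2 (by omega)
  · rw [one_mul]
    congr 1
    ext k
    simp only [upperPart, Finset.mem_filter, and_congr_right_iff]
    intro hk
    have : k.val ≠ i.val := fun e => h (Fin.ext e ▸ hk)
    omega

lemma orderedProd_lowerPart_succ (a : Fin n → ℍ[ℝ]) (i : Fin n) (L : Finset (Fin n)) :
    orderedProd a (lowerPart (i + 1) L) =
      orderedProd a (lowerPart i L) * (if i ∈ L then a i else 1) := by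
  split_ifs with h
  · rw [← orderedProd_insert_max]
    · congr 1
      ext k
      simp only [lowerPart, Finset.mem_insert, Finset.mem_filter, Fin.ext_iff]
      constructor
      · rintro ⟨hk, h2⟩
        by_cases hki : k.val = i.val
        · exact Or.inl hki
        · exact Or.inr ⟨hk, by omega⟩
      · rintro (hk | hk)
        · rw [Fin.ext hk]; exact ⟨h, by omega⟩
        · exact ⟨hk.1, by omega⟩
    · intro x hx
      simp only [lowerPart, Finset.mem_filter] at hx
      exact Fin.lt_def.2 (by omega)
  · rw [mul_one]
    congr 1
    ext k
    simp only [lowerPart, Finset.mem_filter, and_congr_right_iff]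
    intro hk
    have : k.val ≠ i.val := fun e => h (Fin.ext e ▸ hk)
    omega

/-! ### Sums over sets of indices -/

lemma sum_finset_eq_sum_erase {M : Type*} [AddCommMonoid M] (h : Fin n)
    (φ : Finset (Fin n) → M) :
    ∑ K, φ K = ∑ K ∈ (Finset.univ.erase h).powerset, (φ K + φ (insert h K)) := by
  rw [← Finset.powerset_univ, ← Finset.insert_erase (Finset.mem_univ h),
    Finset.sum_powerset_insert (Finset.notMem_erase _ _), Finset.erase_insert_eq_erase,
    Finset.sum_add_distrib]
  simp

/-- The complex structure `𝒥_h` becomes left multiplication by `J`. -/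
lemma sum_mul_complexStructure (h : Fin n) {J : ℍ[ℝ]} (hJ : J * J = -1)
    (w : Finset (Fin n) → ℍ[ℝ]) (hw : ∀ K, h ∉ K → w (insert h K) = J * w K) (v : StemSpace n) :
    ∑ K, w K * complexStructure h v K = J * ∑ K, w K * v K := by
  rw [sum_finset_eq_sum_erase h, sum_finset_eq_sum_erase h, Finset.mul_sum]
  refine Finset.sum_congr rfl fun K hK => ?_
  have hK : h ∉ K := fun hh => by simpa using Finset.mem_powerset.1 hK hh
  simp only [complexStructure, hK, if_false, Finset.mem_insert_self, if_true,
    Finset.erase_insert hK, hw K hK, mul_add]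
  rw [← mul_assoc J (J * w K), ← mul_assoc J J, hJ]
  simp only [neg_mul, one_mul, mul_neg, mul_assoc]
  abel

/-- The coefficient of the component `L` of a stem function in the `K`-th iterated spherical
operator, contributed by the `k`-th variable. -/
def gammaCoef (K L : Finset (Fin n)) (z : Fin n → ℂ) (k : Fin n) : ℝ :=
  if k ∈ L then (if k ∈ K then (z k).re / (z k).im else ((z k).im)⁻¹) else (if k ∈ K then 1 else 0)

/-- The product of the coefficients `gammaCoef` of the first `j` variables. -/
def gammaProd (j : ℕ) (K L : Finset (Fin n)) (z : Fin n → ℂ) : ℝ :=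
  ∏ k ∈ lowerPart j Finset.univ, gammaCoef K L z k

@[simp] lemma gammaProd_zero (K L : Finset (Fin n)) (z : Fin n → ℂ) : gammaProd 0 K L z = 1 := by
  simp [gammaProd, lowerPart]

lemma lowerPart_succ_univ (i : Fin n) :
    lowerPart (i + 1) (Finset.univ : Finset (Fin n)) =
      insert i (lowerPart i (Finset.univ : Finset (Fin n))) := by
  ext k
  simp only [lowerPart, Finset.mem_insert, Finset.mem_filter, Fin.ext_iff, Finset.mem_univ,
    true_and]
  omega

lemma notMem_lowerPart_self (i : Fin n) (L : Finset (Fin n)) : i ∉ lowerPart i L := by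
  simp [lowerPart]

lemma gammaProd_succ (i : Fin n) (K L : Finset (Fin n)) (z : Fin n → ℂ) :
    gammaProd (i + 1) K L z = gammaCoef K L z i * gammaProd i K L z := by
  rw [gammaProd, lowerPart_succ_univ, Finset.prod_insert (notMem_lowerPart_self i _), gammaProd]

lemma gammaProd_congr {j : ℕ} {K K' L L' : Finset (Fin n)} {z z' : Fin n → ℂ}
    (hK : ∀ k : Fin n, k.val < j → (k ∈ K ↔ k ∈ K'))
    (hL : ∀ k : Fin n, k.val < j → (k ∈ L ↔ k ∈ L'))
    (hz : ∀ k : Fin n, k.val < j → z k = z' k) :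
    gammaProd j K L z = gammaProd j K' L' z' := by
  refine Finset.prod_congr rfl fun k hk => ?_
  have hk : k.val < j := by simpa [lowerPart] using hk
  simp only [gammaCoef, hK k hk, hL k hk, hz k hk]

/-- The imaginary part of `J * J` is `2 Re(J) Im(J)`. If `Re(J)` were nonzero, `J` would be real
with square `-1`. -/
lemma star_of_mul_self {J : ℍ[ℝ]} (hJ : J * J = -1) : star J = -J := by
  have h := hJ
  rw [Quaternion.ext_iff] at h
  simp only [Quaternion.re_mul, Quaternion.imI_mul, Quaternion.imJ_mul, Quaternion.imK_mul,
    Quaternion.re_neg, Quaternion.imI_neg, Quaternion.imJ_neg, Quaternion.imK_neg,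
    Quaternion.re_one, Quaternion.imI_one, Quaternion.imJ_one, Quaternion.imK_one] at h
  obtain ⟨h0, h1, h2, h3⟩ := h
  have hre : J.re = 0 := by
    by_contra hne
    have e1 : J.imI = 0 := by
      have : J.re * J.imI = 0 := by linarith
      simpa [hne] using this
    have e2 : J.imJ = 0 := by
      have : J.re * J.imJ = 0 := by linarith
      simpa [hne] using this
    have e3 : J.imK = 0 := by
      have : J.re * J.imK = 0 := by linarith
      simpa [hne] using this
    rw [e1, e2, e3] at h0
    nlinarith [sq_nonneg J.re]
  ext <;> simp [hre]

/-- The reassembling identity behind the definition of the conjugate Wirtinger operators. -/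
lemma sum_orderedProd_mul_gammaProd {z : Fin n → ℂ} (hz : ∀ k, (z k).im ≠ 0)
    {J : Fin n → ℍ[ℝ]} (hJ : ∀ k, J k ∈ imagUnits) (L : Finset (Fin n)) (j : ℕ) (hj : j ≤ n) :
    ∑ K ∈ (lowerPart j (Finset.univ : Finset (Fin n))).powerset,
      gammaProd j K L z • orderedProd (fun k => -star (slicePoint J z k))
        (lowerPart j Finset.univ \ K) = orderedProd J (lowerPart j L) := by
  induction j with
  | zero => simp [lowerPart]
  | succ j ih =>
    have ih := ih (by omega)
    set i : Fin n := ⟨j, hj⟩ with hi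
    have hij : j = i.val := rfl
    rw [hij] at ih ⊢
    -- The subsets of the first `i + 1` indices pair up as `K` and `insert i K`; each pair must
    -- contribute the term of `K` times one factor for the index `i`.
    rw [orderedProd_lowerPart_succ, ← ih, lowerPart_succ_univ,
      Finset.sum_powerset_insert (notMem_lowerPart_self i _), ← Finset.sum_add_distrib,
      Finset.sum_mul]
    refine Finset.sum_congr rfl fun K hK => ?_
    have hKs := Finset.mem_powerset.1 hK
    have hiK : i ∉ K := fun h => notMem_lowerPart_self i _ (hKs h)
    have e1 : insert i (lowerPart i Finset.univ) \ K = insert i (lowerPart i Finset.univ \ K) := by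
      rw [Finset.insert_sdiff_of_notMem _ hiK]
    have e2 : insert i (lowerPart i Finset.univ) \ insert i K = lowerPart i Finset.univ \ K := by
      rw [Finset.insert_sdiff_insert, Finset.sdiff_insert_of_notMem (notMem_lowerPart_self i _)]
    have e3 : gammaProd i (insert i K) L z = gammaProd i K L z := by
      refine gammaProd_congr (fun k hk => ?_) (fun _ _ => Iff.rfl) fun _ _ => rfl
      have : k ≠ i := fun h => by simp [h] at hk
      simp [this]
    rw [e1, e2, gammaProd_succ, gammaProd_succ, e3, orderedProd_insert_max]
    · set P := orderedProd (fun k => -star (slicePoint J z k)) (lowerPart i Finset.univ \ K)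
      simp only [gammaCoef, hiK, if_false, Finset.mem_insert_self, if_true]
      by_cases hL : i ∈ L
      · simp only [hL, if_true]
        have hβ := hz i
        have hs : star (slicePoint J z i) = ((z i).re : ℍ[ℝ]) - J i * ((z i).im : ℍ[ℝ]) := by
          simp only [slicePoint, star_add, star_mul, Quaternion.star_coe,
            star_of_mul_self (hJ i), mul_neg, Quaternion.coe_commutes]
          abel
        rw [hs]
        -- This is `β⁻¹(-x̄) + α/β = J`: the first term comes from `K`, where `-x̄` is present, the
        -- second from `insert i K`.
        have : (z i).im⁻¹ • -((((z i).re : ℝ) : ℍ[ℝ]) - J i * (((z i).im : ℝ) : ℍ[ℝ]))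
            + ((z i).re / (z i).im) • (1 : ℍ[ℝ]) = J i := by
          ext <;> simp <;> field_simp <;> ring
        generalize ((z i).re : ℍ[ℝ]) - J i * ((z i).im : ℍ[ℝ]) = w at this
        rw [← this]
        simp only [mul_add, mul_smul_comm, smul_mul_assoc, smul_smul, mul_one]
      · simp [hL]
    · intro x hx
      have : x.val < i.val := by
        have := (Finset.mem_sdiff.1 hx).1
        simpa [lowerPart] using this
      exact Fin.lt_def.2 this

/-! ### Inversion of a stem function -/

/-- The character `(-1)^|S ∩ K|`. -/
def conjSign (S K : Finset (Fin n)) : ℝ := ∏ k, if k ∈ S ∧ k ∈ K then -1 else 1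

lemma conjSign_eq_prod (S K : Finset (Fin n)) :
    conjSign S K = ∏ k ∈ K, if k ∈ S then (-1 : ℝ) else 1 := by
  rw [conjSign, ← Finset.prod_subset (Finset.subset_univ K)]
  · exact Finset.prod_congr rfl fun k hk => by simp [hk]
  · intro k _ hk; simp [hk]

/-- Orthogonality of the characters of `(ℤ/2)ⁿ`. The sum over `S` factors over the indices, and an
index in exactly one of `K`, `L` gives a factor `1 - 1`. -/
lemma sum_conjSign_mul_conjSign (K L : Finset (Fin n)) :
    ∑ S, conjSign S L * conjSign S K = if K = L then (2 : ℝ) ^ n else 0 := by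
  have h : ∀ S : Finset (Fin n), conjSign S L * conjSign S K =
      ∏ k ∈ S, ((if k ∈ L then (-1 : ℝ) else 1) * (if k ∈ K then (-1 : ℝ) else 1)) := by
    intro S
    rw [conjSign, conjSign, ← Finset.prod_mul_distrib,
      ← Finset.prod_subset (Finset.subset_univ S)]
    · exact Finset.prod_congr rfl fun k hk => by simp [hk]
    · intro k _ hk; simp [hk]
  simp_rw [h]
  rw [← Finset.powerset_univ, ← Finset.prod_one_add]
  split_ifs with hKL
  · subst hKL
    have : ∀ k : Fin n, (1 : ℝ) + ((if k ∈ K then (-1 : ℝ) else 1) *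
        (if k ∈ K then (-1 : ℝ) else 1)) = 2 := fun k => by split_ifs <;> norm_num
    simp only [this, Finset.prod_const, Finset.card_univ, Fintype.card_fin]
  · obtain ⟨k, hk⟩ : ∃ k, ¬(k ∈ K ↔ k ∈ L) := by
      by_contra hcon
      push Not at hcon
      exact hKL (Finset.ext hcon)
    refine Finset.prod_eq_zero (Finset.mem_univ k) ?_
    by_cases h1 : k ∈ K <;> by_cases h2 : k ∈ L <;> simp_all

/-- Fourier inversion on `(ℤ/2)ⁿ`. It serves twice: for signs put on the units and for signs
produced by conjugating coordinates. -/
lemma sum_conjSign_smul (q : ℍ[ℝ]) (v : StemSpace n) (L : Finset (Fin n)) :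
    ∑ S, conjSign S L • ∑ K : Finset (Fin n), conjSign S K • (q ^ K.card * v K) =
      (2 : ℝ) ^ n • (q ^ L.card * v L) := by
  simp_rw [Finset.smul_sum, smul_smul]
  rw [Finset.sum_comm]
  simp_rw [← Finset.sum_smul, sum_conjSign_mul_conjSign]
  simp [ite_smul]

@[simp] lemma re_unitVec (i : Fin 3) : (unitVec i).re = 0 := by fin_cases i <;> rfl

lemma unitVec_zero_mul_self : unitVec 0 * unitVec 0 = -1 := by
  have h : unitVec 0 = ((⟨0, 1⟩ : ℂ) : ℍ[ℝ]) := rfl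
  rw [h, ← Quaternion.coeComplex_mul]
  ext <;> simp

/-- The choices `J_k = ±i` already suffice: these units commute, the signs come out as characters,
and inversion isolates each component. -/
lemma stemSpace_eq_zero {v : StemSpace n}
    (h : ∀ J : Fin n → ℍ[ℝ], (∀ k, J k ∈ imagUnits) → ∑ K, orderedProd J K * v K = 0) :
    v = 0 := by
  funext L
  have hi := unitVec_zero_mul_self
  have h0 : unitVec 0 ≠ 0 := fun h => by simp [h] at hi
  have key := sum_conjSign_smul (unitVec 0) v L
  have hz : ∀ S : Finset (Fin n),
      ∑ K : Finset (Fin n), conjSign S K • (unitVec 0 ^ K.card * v K) = 0 := by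
    intro S
    have := h (fun k => (if k ∈ S then (-1 : ℝ) else 1) • unitVec 0) (fun k => by
      simp only [imagUnits, Set.mem_ofPred_eq]
      split_ifs <;> simp [hi])
    rw [← this]
    refine Finset.sum_congr rfl fun K _ => ?_
    rw [orderedProd_smul_const, conjSign_eq_prod, smul_mul_assoc]
  simp only [hz, smul_zero, Finset.sum_const_zero] at key
  have := key.symm
  simpa [h0] using this

end

section


open Set Filter Topology Complex
open scoped Interval

/-! ### Removability of the real axes for continuous functions -/

/-- Morera's theorem: a rectangle crossing the real axis is cut along it. -/
lemma differentiableOn_of_continuousOn_of_im_ne_zero {f : ℂ → ℂ} {U : Set ℂ} (hU : IsOpen U)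
    (hf : ContinuousOn f U) (hd : ∀ z ∈ U, z.im ≠ 0 → DifferentiableAt ℂ f z) :
    DifferentiableOn ℂ f U := by
  rw [← isConservativeOn_and_continuousOn_iff_isDifferentiableOn hU]
  refine ⟨fun z w hzw => ?_, hf⟩
  rw [← add_eq_zero_iff_eq_neg, wedgeIntegral_add_wedgeIntegral_eq]
  have hrect : [[z.re, w.re]] ×ℂ [[z.im, w.im]] ⊆ U := hzw
  by_cases h0 : (0 : ℝ) ∈ [[z.im, w.im]]
  -- A rectangle on one side of the axis may have an edge on it, but its interior avoids it.
  -- Cauchy's theorem needs only continuity on the boundary.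
  · have hsub : ∀ {a b : ℝ}, a ∈ [[z.im, w.im]] → b ∈ [[z.im, w.im]] →
        (a ≤ 0 ∧ b ≤ 0 ∨ 0 ≤ a ∧ 0 ≤ b) →
        (∫ x : ℝ in z.re..w.re, f (x + a * I)) - (∫ x : ℝ in z.re..w.re, f (x + b * I)) +
          I • (∫ y : ℝ in a..b, f (w.re + y * I)) -
          I • (∫ y : ℝ in a..b, f (z.re + y * I)) = 0 := by
      intro a b ha hb hab
      have hs : [[a, b]] ⊆ [[z.im, w.im]] := uIcc_subset_uIcc ha hb
      have := integral_boundary_rect_eq_zero_of_continuousOn_of_differentiableOn f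
        ⟨z.re, a⟩ ⟨w.re, b⟩ (hf.mono ((reProdIm_subset_iff.2 (prod_mono subset_rfl hs)).trans hrect))
        (fun x hx => ?_)
      · exact this
      · rw [mem_reProdIm] at hx
        refine (hd x (hrect ?_) ?_).differentiableWithinAt
        · rw [mem_reProdIm]
          exact ⟨Ioo_subset_Icc_self hx.1, hs (Ioo_subset_Icc_self hx.2)⟩
        · rcases hab with ⟨h1, h2⟩ | ⟨h1, h2⟩
          · exact (hx.2.2.trans_le (max_le h1 h2)).ne
          · exact ((le_min h1 h2).trans_lt hx.2.1).ne'
    have hint : ∀ {c : ℝ}, c ∈ [[z.re, w.re]] → ∀ {a b : ℝ}, a ∈ [[z.im, w.im]] →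
        b ∈ [[z.im, w.im]] →
        IntervalIntegrable (fun y : ℝ => f (c + y * I)) MeasureTheory.volume a b := by
      intro c hc a b ha hb
      refine ContinuousOn.intervalIntegrable ?_
      refine hf.comp (by fun_prop) fun y hy => hrect ?_
      rw [mem_reProdIm]
      exact ⟨by simpa using hc, by simpa using uIcc_subset_uIcc ha hb hy⟩
    have e1 : (∫ x : ℝ in z.re..w.re, f (x + z.im * I)) -
          (∫ x : ℝ in z.re..w.re, f (x + (0 : ℝ) * I)) +
          I • (∫ y : ℝ in z.im..0, f (w.re + y * I)) -
          I • (∫ y : ℝ in z.im..0, f (z.re + y * I)) = 0 :=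
      hsub left_mem_uIcc h0 (by rcases le_total z.im 0 with h | h <;> simp [h])
    have e2 : (∫ x : ℝ in z.re..w.re, f (x + (0 : ℝ) * I)) -
          (∫ x : ℝ in z.re..w.re, f (x + w.im * I)) +
          I • (∫ y : ℝ in 0..w.im, f (w.re + y * I)) -
          I • (∫ y : ℝ in 0..w.im, f (z.re + y * I)) = 0 :=
      hsub h0 right_mem_uIcc (by rcases le_total w.im 0 with h | h <;> simp [h])
    -- The vertical edges are split at height `0`; the common edge on the axis cancels in `e1 + e2`.
    rw [← intervalIntegral.integral_add_adjacent_intervals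
        (hint right_mem_uIcc left_mem_uIcc h0) (hint right_mem_uIcc h0 right_mem_uIcc),
      ← intervalIntegral.integral_add_adjacent_intervals
        (hint left_mem_uIcc left_mem_uIcc h0) (hint left_mem_uIcc h0 right_mem_uIcc)]
    simp only [smul_eq_mul] at e1 e2 ⊢
    linear_combination e1 + e2
  · refine integral_boundary_rect_eq_zero_of_differentiableOn f z w fun x hx => ?_
    refine (hd x (hrect hx) fun h => h0 ?_).differentiableWithinAt
    rw [← h]
    exact (mem_reProdIm.1 hx).2

/-! ### Separate holomorphy in several complex variables -/

variable {n : ℕ}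

lemma dense_forall_im_ne_zero : Dense {z : Fin n → ℂ | ∀ k, (z k).im ≠ 0} := by
  have h : Dense {z : ℂ | z.im ≠ 0} :=
    (dense_compl_singleton (0 : ℝ)).preimage isOpenMap_im
  have := dense_pi (univ : Set (Fin n)) (s := fun _ => {z : ℂ | z.im ≠ 0}) fun _ _ => h
  convert this using 1
  ext z; simp

/-- Strict differentiability from continuous partial derivatives. -/
lemma hasStrictFDerivAt_of_continuousOn_partial {f : (Fin n → ℂ) → ℂ} {U : Set (Fin n → ℂ)}
    (hU : IsOpen U) {p : Fin n → (Fin n → ℂ) → ℂ}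
    (hp : ∀ h, ∀ z ∈ U, HasDerivAt (fun t => f (Function.update z h t)) (p h z) (z h))
    (hc : ∀ h, ContinuousOn (p h) U) {z : Fin n → ℂ} (hz : z ∈ U) :
    HasStrictFDerivAt f
      (∑ h, p h z • (ContinuousLinearMap.proj h : (Fin n → ℂ) →L[ℂ] ℂ)) z := by
  induction n with
  | zero =>
    have : f = fun _ => f z := funext fun y => by rw [Subsingleton.elim y z]
    rw [this]
    simpa using hasStrictFDerivAt_const (𝕜 := ℂ) (f z) z
  | succ n ih =>
    let e : ((Fin (n + 1)) → ℂ) →L[ℂ] ℂ × (Fin n → ℂ) :=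
      (ContinuousLinearMap.proj 0).prod
        (ContinuousLinearMap.pi fun i => ContinuousLinearMap.proj i.succ)
    let g : ℂ → (Fin n → ℂ) → ℂ := fun a w => f (Fin.cons a w)
    have hcons : Continuous fun q : ℂ × (Fin n → ℂ) => (Fin.cons q.1 q.2 : Fin (n + 1) → ℂ) :=
      continuous_pi fun i => by
        refine Fin.cases ?_ (fun i => ?_) i
        · simpa using continuous_fst
        · simpa using (by fun_prop : Continuous fun q : ℂ × (Fin n → ℂ) => q.2 i)
    have hez : (Fin.cons (e z).1 (e z).2 : Fin (n + 1) → ℂ) = z := by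
      ext i; refine Fin.cases ?_ (fun i => ?_) i <;> simp [e]
    let V : Set (ℂ × (Fin n → ℂ)) :=
      (fun q : ℂ × (Fin n → ℂ) => (Fin.cons q.1 q.2 : Fin (n + 1) → ℂ)) ⁻¹' U
    have hV : IsOpen V := hU.preimage hcons
    have heV : e z ∈ V := by simpa [V, hez] using hz
    have hcp : ∀ h, ContinuousOn (fun q : ℂ × (Fin n → ℂ) => p h (Fin.cons q.1 q.2)) V :=
      fun h => (hc h).comp hcons.continuousOn fun q hq => hq
    -- The first variable is split off. Continuous partial derivatives along the two factors `ℂ` and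
    -- `ℂⁿ` give strict differentiability on the product.
    have key : HasStrictFDerivAt (Function.uncurry g) _ (e z) :=
      hasStrictFDerivAt_uncurry_coprod (f := g) (u := e z)
        (f₁ := fun a w => p 0 (Fin.cons a w) • ContinuousLinearMap.id ℂ ℂ)
        (f₂ := fun a w => ∑ h : Fin n, p h.succ (Fin.cons a w) •
          (ContinuousLinearMap.proj h : (Fin n → ℂ) →L[ℂ] ℂ)) ?_ ?_ ?_ ?_
    · have h1 := key.comp z e.hasStrictFDerivAt
      have h2 : (Function.uncurry g) ∘ e = f := by
        funext y
        change f (Fin.cons (y 0) fun i => y (Fin.succ i)) = f y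
        congr 1
        ext i; refine Fin.cases ?_ (fun i => ?_) i <;> rfl
      rw [← h2]
      refine h1.congr_fderiv ?_
      ext y
      simp [Fin.sum_univ_succ, Function.HasUncurry.uncurry, hez]
      rfl
    · filter_upwards [hV.mem_nhds heV] with q hq
      have := (hp 0 _ hq).hasFDerivAt
      simp only [Fin.update_cons_zero, Fin.cons_zero] at this
      refine this.congr_fderiv ?_
      ext; simp [Function.HasUncurry.uncurry]
    · filter_upwards [hV.mem_nhds heV] with q hq
      refine (ih (f := g q.1) (U := {w | (q.1, w) ∈ V})
        (hV.preimage (by fun_prop : Continuous fun w : Fin n → ℂ => (q.1, w)))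
        (p := fun h w => p h.succ (Fin.cons q.1 w)) (fun h w hw => ?_) (fun h => ?_)
        hq).hasFDerivAt
      · simpa [g, Fin.cons_update] using hp h.succ _ hw
      · exact (hcp h.succ).comp (f := fun w : Fin n → ℂ => (q.1, w)) (by fun_prop) fun w hw => hw
    · exact (((hcp 0).continuousAt (hV.mem_nhds heV)).smul continuousAt_const)
    · exact tendsto_finsetSum Finset.univ fun (h : Fin n) _ =>
        (((hcp h.succ).continuousAt (hV.mem_nhds heV)).smul
          (continuousAt_const (y := (ContinuousLinearMap.proj h : (Fin n → ℂ) →L[ℂ] ℂ)))).tendsto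

lemma contDiffOn_one_of_continuousOn_partial {f : (Fin n → ℂ) → ℂ} {U : Set (Fin n → ℂ)}
    (hU : IsOpen U) {p : Fin n → (Fin n → ℂ) → ℂ}
    (hp : ∀ h, ∀ z ∈ U, HasDerivAt (fun t => f (Function.update z h t)) (p h z) (z h))
    (hc : ∀ h, ContinuousOn (p h) U) : ContDiffOn ℂ 1 f U := by
  have hs := fun z hz => (hasStrictFDerivAt_of_continuousOn_partial hU hp hc (z := z) hz)
  rw [← zero_add (1 : WithTop ℕ∞), contDiffOn_succ_iff_fderiv_of_isOpen hU, contDiffOn_zero]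
  refine ⟨fun z hz => (hs z hz).hasFDerivAt.differentiableAt.differentiableWithinAt, by simp, ?_⟩
  refine ContinuousOn.congr (f := fun z => ∑ h, p h z •
    (ContinuousLinearMap.proj h : (Fin n → ℂ) →L[ℂ] ℂ)) ?_ fun z hz => (hs z hz).hasFDerivAt.fderiv
  exact continuousOn_finsetSum _ fun h _ => (hc h).smul continuousOn_const

/-- A continuous function of several complex variables that is separately holomorphic at the points
without real coordinates is holomorphic. -/
theorem contDiffOn_one_of_separately {g : (Fin n → ℂ) → ℂ} {U : Set (Fin n → ℂ)}
    (hU : IsOpen U) (hg : ContinuousOn g U)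
    (hd : ∀ z ∈ U, (∀ k, (z k).im ≠ 0) →
      ∀ h, DifferentiableAt ℂ (fun t => g (Function.update z h t)) (z h)) :
    ContDiffOn ℂ 1 g U := by
  have hcu : ∀ h : Fin n, Continuous fun q : (Fin n → ℂ) × ℂ => Function.update q.1 h q.2 :=
    fun h => continuous_fst.update h continuous_snd
  have key : ∀ h, ∀ z ∈ U, DifferentiableAt ℂ (fun t => g (Function.update z h t)) (z h) ∧
      ContinuousAt (fun w => deriv (fun t => g (Function.update w h t)) (w h)) z := by
    intro h z hz
    have hW : IsOpen ((fun q : (Fin n → ℂ) × ℂ => Function.update q.1 h q.2) ⁻¹' U) :=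
      hU.preimage (hcu h)
    have hzW : (z, z h) ∈ ((fun q : (Fin n → ℂ) × ℂ => Function.update q.1 h q.2) ⁻¹' U) := by
      simpa using hz
    obtain ⟨A, B, hA, hB, hzA, hzB, hAB⟩ := isOpen_prod_iff.1 hW z (z h) hzW
    have hcont : ContinuousOn (fun q : (Fin n → ℂ) × ℂ => g (Function.update q.1 h q.2))
        (A ×ˢ B) := hg.comp (hcu h).continuousOn fun q hq => hAB hq
    have hslice : ∀ w ∈ A, ContinuousOn (fun t => g (Function.update w h t)) B := fun w hw =>
      hcont.comp (f := fun t : ℂ => (w, t)) (t := A ×ˢ B) (by fun_prop)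
        fun t (ht : t ∈ B) => (⟨hw, ht⟩ : (w, t) ∈ A ×ˢ B)
    -- Joint continuity makes nearby slices converge locally uniformly. The filter is left free: it
    -- is later the trace of `𝓝 w` on the points without real coordinates, and then `𝓝 z` itself.
    have htl : ∀ (φ : Filter (Fin n → ℂ)), ∀ w ∈ A, φ ≤ 𝓝 w →
        TendstoLocallyUniformlyOn (fun (w' : Fin n → ℂ) t => g (Function.update w' h t))
          (fun t => g (Function.update w h t)) φ B := by
      intro φ w hw hφ
      rw [tendstoLocallyUniformlyOn_iff_forall_tendsto]
      intro t ht
      have h1 : Tendsto (fun y : (Fin n → ℂ) × ℂ => g (Function.update w h y.2)) (φ ×ˢ 𝓝[B] t)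
          (𝓝 (g (Function.update w h t))) :=
        ((hslice w hw) t ht).tendsto.comp tendsto_snd
      have h2 : Tendsto (fun y : (Fin n → ℂ) × ℂ => g (Function.update y.1 h y.2)) (φ ×ˢ 𝓝[B] t)
          (𝓝 (g (Function.update w h t))) := by
        have := (hcont.continuousAt (x := (w, t)) ((hA.prod hB).mem_nhds ⟨hw, ht⟩)).tendsto
        refine this.mono_left ?_
        rw [nhds_prod_eq]
        exact prod_mono hφ nhdsWithin_le_nhds
      exact (h1.prodMk_nhds h2).mono_right (nhds_le_uniformity _)
    have hdiff0 : ∀ w ∈ A, (∀ k, (w k).im ≠ 0) →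
        DifferentiableOn ℂ (fun t => g (Function.update w h t)) B := by
      intro w hw hwk
      refine differentiableOn_of_continuousOn_of_im_ne_zero hB (hslice w hw) fun t ht htim => ?_
      have := hd (Function.update w h t) (hAB (show (w, t) ∈ A ×ˢ B from ⟨hw, ht⟩)) (fun k => by
        by_cases hk : k = h
        · subst hk; simpa using htim
        · simpa [hk] using hwk k) h
      simpa using this
    -- When `w` has real coordinates, its slice is a locally uniform limit of slices already known
    -- to be holomorphic.
    have hdiff : ∀ w ∈ A, DifferentiableOn ℂ (fun t => g (Function.update w h t)) B := by
      intro w hw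
      have : (𝓝[{z : Fin n → ℂ | ∀ k, (z k).im ≠ 0}] w).NeBot :=
        mem_closure_iff_nhdsWithin_neBot.1 (dense_forall_im_ne_zero w)
      refine (htl (𝓝[{z : Fin n → ℂ | ∀ k, (z k).im ≠ 0}] w) w hw
        nhdsWithin_le_nhds).differentiableOn ?_ hB
      filter_upwards [self_mem_nhdsWithin, nhdsWithin_le_nhds (hA.mem_nhds hw)] with w' h1 h2
      exact hdiff0 w' h2 h1
    refine ⟨(hdiff z hzA).differentiableAt (hB.mem_nhds hzB), ?_⟩
    -- By Weierstrass the derivatives converge locally uniformly as well, which makes the partial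
    -- derivative jointly continuous.
    have hder := (htl (𝓝 z) z hzA le_rfl).deriv
      (by filter_upwards [hA.mem_nhds hzA] with w hw using hdiff w hw) hB
    have hzt : Tendsto (fun w : Fin n → ℂ => w h) (𝓝 z) (𝓝[B] (z h)) := by
      rw [hB.nhdsWithin_eq hzB]
      exact (continuous_apply h).continuousAt
    exact hder.tendsto_comp (((hdiff z hzA).deriv hB).continuousOn _ hzB) hzB hzt
  exact contDiffOn_one_of_continuousOn_partial hU
    (p := fun h w => deriv (fun t => g (Function.update w h t)) (w h))
    (fun h z hz => (key h z hz).1.hasDerivAt)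
    (fun h z hz => (key h z hz).2.continuousWithinAt)

end

section


open Set Filter Topology

variable {n : ℕ}

/-! ### Points of slices -/

lemma mem_imagUnits_iff {J : ℍ[ℝ]} :
    J ∈ imagUnits ↔ J.re = 0 ∧ J.imI ^ 2 + J.imJ ^ 2 + J.imK ^ 2 = 1 := by
  constructor
  · intro hJ
    have hre : J.re = 0 := by
      have := congrArg (·.re) (star_of_mul_self hJ)
      simp only [Quaternion.re_star, Quaternion.re_neg] at this
      linarith
    have := congrArg (·.re) (show J * J = -1 from hJ)
    simp only [Quaternion.re_mul, Quaternion.re_neg, Quaternion.re_one, hre] at this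
    exact ⟨hre, by linarith⟩
  · rintro ⟨h0, h1⟩
    change J * J = -1
    ext <;> simp [h0] <;> linarith

lemma slicePoint_apply (J : Fin n → ℍ[ℝ]) (z : Fin n → ℂ) (k : Fin n) :
    slicePoint J z k = ((z k).re : ℍ[ℝ]) + (z k).im • J k := by
  rw [slicePoint, Quaternion.mul_coe_eq_smul]

lemma im_slicePoint {J : Fin n → ℍ[ℝ]} (hJ : ∀ k, J k ∈ imagUnits) (z : Fin n → ℂ) (k : Fin n) :
    (slicePoint J z k).im = (z k).im • J k := by
  have := (mem_imagUnits_iff.1 (hJ k)).1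
  rw [slicePoint_apply]
  ext <;> simp [this]

/-- The real linear map `z ↦ slicePoint J z`. -/
def sliceMap (J : Fin n → ℍ[ℝ]) : (Fin n → ℂ) →L[ℝ] (Fin n → ℍ[ℝ]) :=
  ContinuousLinearMap.pi fun k =>
    (Complex.reCLM.smulRight (1 : ℍ[ℝ]) + Complex.imCLM.smulRight (J k)) ∘L
      (ContinuousLinearMap.proj k : (Fin n → ℂ) →L[ℝ] ℂ)

lemma sliceMap_apply (J : Fin n → ℍ[ℝ]) (z : Fin n → ℂ) : sliceMap J z = slicePoint J z := by
  funext k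
  rw [slicePoint_apply]
  simp [sliceMap, Algebra.smul_def]

lemma slicePoint_single_one (J : Fin n → ℍ[ℝ]) (m : Fin n) :
    slicePoint J (Pi.single m 1) = Pi.single m 1 := by
  funext k
  rw [slicePoint_apply]
  by_cases h : k = m
  · subst h; simp
  · simp [h]

lemma slicePoint_single_I (J : Fin n → ℍ[ℝ]) (m : Fin n) :
    slicePoint J (Pi.single m Complex.I) = Pi.single m (J m) := by
  funext k
  rw [slicePoint_apply]
  by_cases h : k = m
  · subst h; simp
  · simp [h]

lemma slicePoint_update (J : Fin n → ℍ[ℝ]) (z : Fin n → ℂ) (i : Fin n) (I : ℍ[ℝ]) :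
    slicePoint (Function.update J i I) z =
      slicePoint J z + Pi.single i ((z i).im • (I - J i)) := by
  funext k
  rw [Pi.add_apply, slicePoint_apply, slicePoint_apply]
  by_cases h : k = i
  · subst h; simp [smul_sub]
  · simp [h]

lemma slicePoint_notMem_realLocus {J : Fin n → ℍ[ℝ]} (hJ : ∀ k, J k ∈ imagUnits)
    {z : Fin n → ℂ} : slicePoint J z ∉ realLocus n ↔ ∀ k, (z k).im ≠ 0 := by
  constructor
  · intro h k hk
    exact h ⟨k, (z k).re, by simp [slicePoint_apply, hk]⟩
  · rintro h ⟨k, r, hr⟩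
    have h1 := im_slicePoint hJ z k
    rw [hr, Quaternion.im_coe] at h1
    have h2 : J k = 0 := by simpa [h k] using h1.symm
    have := (mem_imagUnits_iff.1 (hJ k)).2
    simp [h2] at this

lemma isClosed_realLocus : IsClosed (realLocus n) := by
  have : realLocus n = ⋃ k : Fin n, {x : Fin n → ℍ[ℝ] | (x k).im = 0} := by
    ext x
    simp only [realLocus, mem_iUnion]
    refine exists_congr fun k => ⟨?_, fun h => ⟨(x k).re, ?_⟩⟩
    · rintro ⟨r, hr⟩
      simp [hr]
    · rw [← Quaternion.re_add_im (x k), show (x k).im = 0 from h]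
      simp
  rw [this]
  exact isClosed_iUnion_of_finite fun k =>
    isClosed_eq (Quaternion.continuous_im.comp (continuous_apply k)) continuous_const

/-! ### The spherical Dirac operator on slices -/

lemma imI_unitVec (p : Fin 3) : (unitVec p).imI = ![1, 0, 0] p := by fin_cases p <;> rfl
lemma imJ_unitVec (p : Fin 3) : (unitVec p).imJ = ![0, 1, 0] p := by fin_cases p <;> rfl
lemma imK_unitVec (p : Fin 3) : (unitVec p).imK = ![0, 0, 1] p := by fin_cases p <;> rfl

/-- Each `L_{pq}` differentiates along `x_p e_q - x_q e_p`, which is orthogonal to `Im x`. So `b`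
factors out on the right, and what is left is `-½ ∑ e_p e_q (x_p e_q - x_q e_p) = 2 Im x`. -/
lemma sphericalDirac_eq_of_tangential {g : (Fin n → ℍ[ℝ]) → ℍ[ℝ]} {x : Fin n → ℍ[ℝ]} {i : Fin n}
    {b : ℍ[ℝ]}
    (hT : ∀ v : ℍ[ℝ], v.re = 0 →
      v.imI * (x i).imI + v.imJ * (x i).imJ + v.imK * (x i).imK = 0 →
      fderiv ℝ g x (Pi.single i v) = v * b) :
    sphericalDirac i g x = (2 : ℝ) • ((x i).im * b) := by
  have h1 : ∀ p q : Fin 3, tangentialOp i p q g x =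
      (imCoord (x i) p • unitVec q - imCoord (x i) q • unitVec p) * b := by
    intro p q
    rw [tangentialOp, partialAt, partialAt, ← map_smul, ← map_smul, ← map_sub,
      ← Pi.single_smul', ← Pi.single_smul', ← Pi.single_sub]
    refine hT _ (by simp) ?_
    fin_cases p <;> fin_cases q <;> simp [imCoord, imI_unitVec, imJ_unitVec, imK_unitVec] <;> ring
  have h2 : -((1 / 2 : ℝ) • ∑ p : Fin 3, ∑ q : Fin 3, unitVec p * unitVec q *
      (imCoord (x i) p • unitVec q - imCoord (x i) q • unitVec p)) = (2 : ℝ) • (x i).im := by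
    ext <;> simp [Fin.sum_univ_three, imCoord, imI_unitVec, imJ_unitVec, imK_unitVec] <;> ring
  simp only [sphericalDirac, h1, ← mul_assoc, ← Finset.sum_mul]
  rw [← smul_mul_assoc, ← neg_mul, h2, smul_mul_assoc]

/-- The function is differentiated along the great circle `cos t J_i + sin t I` of units, with `I =
v / ‖v‖` orthogonal to `J_i`. The point moves with velocity `β I`, while the value `A + c(t) B` has
derivative `I B`. -/
lemma fderiv_single_tangential {h : (Fin n → ℍ[ℝ]) → ℍ[ℝ]} {J : Fin n → ℍ[ℝ]} {z : Fin n → ℂ}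
    {i : Fin n} {A B : ℍ[ℝ]} (hJ : ∀ k, J k ∈ imagUnits) (hz : (z i).im ≠ 0)
    (hd : DifferentiableAt ℝ h (slicePoint J z))
    (hAB : ∀ I ∈ imagUnits, h (slicePoint (Function.update J i I) z) = A + I * B)
    {v : ℍ[ℝ]} (hv : v.re = 0)
    (hvJ : v.imI * (J i).imI + v.imJ * (J i).imJ + v.imK * (J i).imK = 0) :
    fderiv ℝ h (slicePoint J z) (Pi.single i v) = v * ((z i).im⁻¹ • B) := by
  by_cases hv0 : v = 0
  · simp [hv0]
  have hr0 : ‖v‖ ≠ 0 := norm_ne_zero_iff.2 hv0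
  have hr : ‖v‖ ^ 2 = v.imI ^ 2 + v.imJ ^ 2 + v.imK ^ 2 := by
    rw [sq, ← Quaternion.normSq_eq_norm_mul_self, Quaternion.normSq_def', hv]; ring
  set r := ‖v‖
  set I : ℍ[ℝ] := r⁻¹ • v with hI
  let c : ℝ → ℍ[ℝ] := fun t => Real.cos t • J i + Real.sin t • I
  have hc : ∀ t, c t ∈ imagUnits := by
    intro t
    obtain ⟨j0, j1⟩ := mem_imagUnits_iff.1 (hJ i)
    rw [mem_imagUnits_iff]
    refine ⟨by simp [c, I, j0, hv], ?_⟩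
    simp only [c, I, Quaternion.imI_add, Quaternion.imJ_add, Quaternion.imK_add,
      Quaternion.imI_smul, Quaternion.imJ_smul, Quaternion.imK_smul, smul_eq_mul]
    have hrr : r⁻¹ ^ 2 * (v.imI ^ 2 + v.imJ ^ 2 + v.imK ^ 2) = 1 := by
      rw [← hr]; field_simp
    linear_combination Real.cos t ^ 2 * j1 + 2 * Real.cos t * Real.sin t * r⁻¹ * hvJ +
      Real.sin t ^ 2 * hrr + Real.sin_sq_add_cos_sq t
  have hcd : HasDerivAt c I 0 := by
    have := ((Real.hasDerivAt_cos 0).smul_const (J i)).add ((Real.hasDerivAt_sin 0).smul_const I)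
    simp only [Real.sin_zero, neg_zero, zero_smul, Real.cos_zero, one_smul, zero_add] at this
    exact this
  have hc0 : c 0 = J i := by simp [c]
  have hy : HasDerivAt (fun t => slicePoint (Function.update J i (c t)) z)
      (Pi.single i ((z i).im • I)) 0 := by
    have h1 : HasDerivAt (fun t => (z i).im • (c t - J i)) ((z i).im • I) 0 :=
      (hcd.sub_const (J i)).const_smul (z i).im
    have h2 := ((ContinuousLinearMap.single ℝ (fun _ : Fin n => ℍ[ℝ]) i).hasFDerivAt
      (x := (z i).im • (c 0 - J i))).comp_hasDerivAt (0 : ℝ) h1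
    have h3 := h2.const_add (slicePoint J z)
    simp only [slicePoint_update]
    exact h3
  have hy0 : slicePoint (Function.update J i (c 0)) z = slicePoint J z := by simp [hc0]
  have e1 : HasDerivAt (fun t => h (slicePoint (Function.update J i (c t)) z))
      (fderiv ℝ h (slicePoint J z) (Pi.single i ((z i).im • I))) 0 := by
    have hd' := hd.hasFDerivAt
    nth_rewrite 2 [← hy0] at hd'
    exact hd'.comp_hasDerivAt (0 : ℝ) hy
  have e2 : HasDerivAt (fun t => h (slicePoint (Function.update J i (c t)) z)) (I * B) 0 := by
    have : (fun t => h (slicePoint (Function.update J i (c t)) z)) = fun t => A + c t * B :=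
      funext fun t => hAB _ (hc t)
    rw [this]
    exact (hcd.mul_const B).const_add A
  have e3 := e1.unique e2
  have hvI : v = (r * (z i).im⁻¹) • ((z i).im • I) := by
    rw [hI, smul_smul, smul_smul]
    field_simp
    simp
  rw [hvI, Pi.single_smul', map_smul, e3]
  simp only [smul_mul_assoc, mul_smul_comm, smul_smul]
  congr 1
  field_simp

lemma two_quaternion_ne_zero : (2 : ℍ[ℝ]) ≠ 0 := by
  rw [show (2 : ℍ[ℝ]) = ((2 : ℝ) : ℍ[ℝ]) by norm_cast]
  exact fun h => two_ne_zero (Quaternion.coe_injective (h.trans Quaternion.coe_zero.symm))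

/-- The normalised operator is thus a spherical derivative: it extracts the coefficient of the
`i`-th unit, divided by `β`. -/
lemma inv_mul_sphericalDirac {h : (Fin n → ℍ[ℝ]) → ℍ[ℝ]} {J : Fin n → ℍ[ℝ]} {z : Fin n → ℂ}
    {i : Fin n} {A B : ℍ[ℝ]} (hJ : ∀ k, J k ∈ imagUnits) (hz : (z i).im ≠ 0)
    (hd : DifferentiableAt ℝ h (slicePoint J z))
    (hAB : ∀ I ∈ imagUnits, h (slicePoint (Function.update J i I) z) = A + I * B) :
    (2 * (slicePoint J z i).im)⁻¹ * sphericalDirac i h (slicePoint J z) = (z i).im⁻¹ • B := by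
  have him := im_slicePoint hJ z i
  rw [sphericalDirac_eq_of_tangential (b := (z i).im⁻¹ • B)]
  · have h0 : (slicePoint J z i).im ≠ 0 := by
      rw [him]
      refine smul_ne_zero hz fun h0 => ?_
      have := (mem_imagUnits_iff.1 (hJ i)).2
      simp [h0] at this
    have : (2 : ℝ) • ((slicePoint J z i).im * ((z i).im⁻¹ • B)) =
        (2 * (slicePoint J z i).im) * ((z i).im⁻¹ • B) := by
      rw [two_smul, two_mul, add_mul]
    rw [this, inv_mul_cancel_left₀ (mul_ne_zero two_quaternion_ne_zero h0)]
  · intro v hv hv2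
    refine fderiv_single_tangential hJ hz hd hAB hv ?_
    have e1 := congrArg (·.imI) him
    have e2 := congrArg (·.imJ) him
    have e3 := congrArg (·.imK) him
    simp only [Quaternion.imI_im, Quaternion.imJ_im, Quaternion.imK_im, Quaternion.imI_smul,
      Quaternion.imJ_smul, Quaternion.imK_smul, smul_eq_mul] at e1 e2 e3
    rw [e1, e2, e3] at hv2
    refine mul_left_cancel₀ hz ?_
    linear_combination hv2

/-! ### Regularity of the iterated spherical operators -/

lemma contDiff_imCoord (p : Fin 3) {k : WithTop ℕ∞} : ContDiff ℝ k fun q : ℍ[ℝ] => imCoord q p := by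
  let L : ℍ[ℝ] →ₗ[ℝ] ℝ :=
    { toFun := fun q => imCoord q p
      map_add' := fun q r => by fin_cases p <;> simp [imCoord]
      map_smul' := fun q r => by fin_cases p <;> simp [imCoord] }
  exact L.toContinuousLinearMap.contDiff

lemma contDiffOn_sphericalDirac {V : Set (Fin n → ℍ[ℝ])} (hV : IsOpen V)
    {g : (Fin n → ℍ[ℝ]) → ℍ[ℝ]} {k : WithTop ℕ∞} (hg : ContDiffOn ℝ (k + 1) g V) (i : Fin n) :
    ContDiffOn ℝ k (sphericalDirac i g) V := by
  have hp : ∀ e, ContDiffOn ℝ k (partialAt i e g) V := fun e =>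
    (hg.fderiv_of_isOpen hV le_rfl).clm_apply contDiffOn_const
  have hi : ∀ p, ContDiffOn ℝ k (fun x : Fin n → ℍ[ℝ] => imCoord (x i) p) V := fun p =>
    ((contDiff_imCoord p).comp (contDiff_apply ℝ ℍ[ℝ] i)).contDiffOn
  have ht : ∀ p q, ContDiffOn ℝ k (tangentialOp i p q g) V := fun p q =>
    ((hi p).smul (hp _)).sub ((hi q).smul (hp _))
  refine ContDiffOn.neg (ContDiffOn.const_smul _ ?_)
  exact ContDiffOn.sum fun p _ => ContDiffOn.sum fun q _ => contDiffOn_const.mul (ht p q)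

lemma contDiff_im {k : WithTop ℕ∞} : ContDiff ℝ k fun q : ℍ[ℝ] => q.im := by
  let L : ℍ[ℝ] →ₗ[ℝ] ℍ[ℝ] :=
    { toFun := fun q => q.im
      map_add' := fun q r => by ext <;> simp
      map_smul' := fun q r => by ext <;> simp }
  exact L.toContinuousLinearMap.contDiff

lemma contDiffOn_inv_two_mul_im {V : Set (Fin n → ℍ[ℝ])} (hV : V ⊆ (realLocus n)ᶜ) (i : Fin n)
    {k : WithTop ℕ∞} : ContDiffOn ℝ k (fun x : Fin n → ℍ[ℝ] => (2 * (x i).im)⁻¹) V := by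
  intro x hx
  have h0 : 2 * (x i).im ≠ 0 := by
    refine mul_ne_zero two_quaternion_ne_zero fun h => hV hx ⟨i, (x i).re, ?_⟩
    rw [← Quaternion.re_add_im (x i), h]
    simp
  have h1 := contDiffAt_ringInverse (n := k) ℝ (Units.mk0 _ h0)
  rw [Units.val_mk0] at h1
  have h2 : ContDiffAt ℝ k (fun x : Fin n → ℍ[ℝ] => 2 * (x i).im) x :=
    contDiffAt_const.mul (contDiff_im.comp (contDiff_apply ℝ ℍ[ℝ] i)).contDiffAt
  have h3 := h1.comp x h2
  refine (h3.congr_of_eventuallyEq ?_).contDiffWithinAt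
  exact Eventually.of_forall fun y => by simp [Ring.inverse_eq_inv']

lemma gammaIter_zero (f : (Fin n → ℍ[ℝ]) → ℍ[ℝ]) (K : Finset (Fin n)) : gammaIter f 0 K = f := rfl

lemma gammaIter_succ (f : (Fin n → ℍ[ℝ]) → ℍ[ℝ]) (i : Fin n) (K : Finset (Fin n))
    (x : Fin n → ℍ[ℝ]) :
    gammaIter f i.succ K x = (2 * (x i).im)⁻¹ * sphericalDirac i
      (fun y => y i ^ (if i ∈ K then 1 else 0) * gammaIter f i.castSucc (K.erase i) y) x := rfl

/-- Each spherical operator costs one derivative. For `m < n` at least one is left, as needed to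
apply the next spherical operator or `globalDbar`. -/
lemma contDiffOn_gammaIter {V : Set (Fin n → ℍ[ℝ])} (hV : IsOpen V) (hVr : V ⊆ (realLocus n)ᶜ)
    {f : (Fin n → ℍ[ℝ]) → ℍ[ℝ]} (hf : ContDiffOn ℝ n f V) (m : Fin (n + 1)) :
    ∀ K, ContDiffOn ℝ ((n - m.val : ℕ) : WithTop ℕ∞) (gammaIter f m K) V := by
  induction m using Fin.induction with
  | zero => intro K; simpa [gammaIter_zero] using hf
  | succ i ih =>
    intro K
    have hi : ((n - i.castSucc.val : ℕ) : WithTop ℕ∞) = ((n - i.succ.val : ℕ) : WithTop ℕ∞) + 1 := by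
      have : n - i.castSucc.val = (n - i.succ.val) + 1 := by
        simp only [Fin.val_castSucc, Fin.val_succ]; omega
      rw [this]; norm_cast
    simp only [funext (gammaIter_succ f i K)]
    refine (contDiffOn_inv_two_mul_im hVr i).mul (contDiffOn_sphericalDirac hV ?_ i)
    rw [← hi]
    exact (((contDiff_apply ℝ ℍ[ℝ] i).pow _).contDiffOn).mul (ih _)

end

section


open Set Filter Topology

variable {n : ℕ}

/-! ### Iterated spherical operators and Wirtinger operators of slice functions -/

lemma slicePoint_mem_circularization {D : Set (Fin n → ℂ)} {z : Fin n → ℂ} (hz : z ∈ D)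
    {J : Fin n → ℍ[ℝ]} (hJ : ∀ k, J k ∈ imagUnits) : slicePoint J z ∈ circularization D :=
  ⟨z, hz, J, hJ, rfl⟩

lemma update_mem_imagUnits {J : Fin n → ℍ[ℝ]} (hJ : ∀ k, J k ∈ imagUnits) (i : Fin n) {I : ℍ[ℝ]}
    (hI : I ∈ imagUnits) (k : Fin n) : Function.update J i I k ∈ imagUnits := by
  by_cases h : k = i
  · subst h; simpa using hI
  · simpa [h] using hJ k

/-- The iterated spherical operators of the slice function induced by `F`. -/
lemma gammaIter_slicePoint {D : Set (Fin n → ℂ)} {F : (Fin n → ℂ) → StemSpace n}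
    {f : (Fin n → ℍ[ℝ]) → ℍ[ℝ]} (hΩ : IsOpen (circularization D)) (hF : Induces D F f)
    (hf : ContDiffOn ℝ n f (circularization D \ realLocus n)) (m : Fin (n + 1)) :
    ∀ K, ∀ z ∈ D, (∀ k, (z k).im ≠ 0) → ∀ J : Fin n → ℍ[ℝ], (∀ k, J k ∈ imagUnits) →
      gammaIter f m K (slicePoint J z) =
        ∑ L, gammaProd m K L z • (orderedProd J (upperPart m L) * F z L) := by
  have hV : IsOpen (circularization D \ realLocus n) := hΩ.sdiff isClosed_realLocus
  induction m using Fin.induction with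
  | zero =>
    intro K z hz _ J hJ
    simp [gammaIter_zero, hF z hz J hJ, upperPart_zero]
  | succ i ih =>
    intro K z hz hzk J hJ
    simp only [Fin.val_castSucc] at ih
    simp only [Fin.val_succ]
    set T : Finset (Fin n) → ℍ[ℝ] := fun L =>
      gammaProd i K L z • (orderedProd J (upperPart (i + 1) L) * F z L) with hT
    have hxV : slicePoint J z ∈ circularization D \ realLocus n :=
      ⟨slicePoint_mem_circularization hz hJ, (slicePoint_notMem_realLocus hJ).2 hzk⟩
    -- The unit `J_i` can occur only as the leftmost factor, so the previous iterate is affine in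
    -- it: `A` collects the `L` without `i`, and `B` those with `i`.
    set A : ℍ[ℝ] := ∑ L, if i ∈ L then 0 else T L with hA
    set B : ℍ[ℝ] := ∑ L, if i ∈ L then T L else 0 with hB
    have hprev : ∀ I ∈ imagUnits, gammaIter f i.castSucc (K.erase i)
        (slicePoint (Function.update J i I) z) = A + I * B := by
      intro I hI
      rw [ih _ z hz hzk _ (update_mem_imagUnits hJ i hI), hA, hB, Finset.mul_sum,
        ← Finset.sum_add_distrib]
      refine Finset.sum_congr rfl fun L _ => ?_
      rw [orderedProd_upperPart, gammaProd_congr (K' := K) (L' := L) (z' := z)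
        (fun k hk => ?_) (fun _ _ => Iff.rfl) (fun _ _ => rfl),
        orderedProd_congr (a := Function.update J i I) (b := J) (fun k hk => ?_)]
      · by_cases h : i ∈ L <;> simp [h, hT, mul_assoc]
      · have : k ≠ i := fun h => by simp [upperPart, h] at hk
        simp [this]
      · have : k ≠ i := fun h => by simp [h] at hk
        simp [this]
    have hprevd : DifferentiableAt ℝ (gammaIter f i.castSucc (K.erase i)) (slicePoint J z) := by
      have h1 := (contDiffOn_gammaIter hV (fun x hx => hx.2) hf i.castSucc (K.erase i)).contDiffAt
        (hV.mem_nhds hxV)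
      refine h1.differentiableAt ?_
      have : n - i.castSucc.val ≠ 0 := by simp only [Fin.val_castSucc]; omega
      exact_mod_cast this
    have hx : ∀ I ∈ imagUnits, slicePoint (Function.update J i I) z i =
        ((z i).re : ℍ[ℝ]) + (z i).im • I := fun I _ => by simp [slicePoint_apply]
    rw [gammaIter_succ]
    by_cases hiK : i ∈ K
    · simp only [hiK, if_true, pow_one]
      -- Here `(α + Iβ)(A + IB) = (αA - βB) + I(βA + αB)`.
      rw [inv_mul_sphericalDirac
        (h := fun y => y i * gammaIter f i.castSucc (K.erase i) y) (A := (z i).re • A - (z i).im • B)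
        (B := (z i).im • A + (z i).re • B) hJ (hzk i)
        (((differentiable_apply i).differentiableAt).mul hprevd)]
      · rw [hA, hB]
        simp only [smul_add, smul_smul, Finset.smul_sum, ← Finset.sum_add_distrib]
        refine Finset.sum_congr rfl fun L _ => ?_
        have h0 := hzk i
        by_cases h : i ∈ L
        · simp [h, hT, gammaProd_succ, gammaCoef, hiK, smul_smul]
          congr 1
          field_simp
        · simp [h, hT, gammaProd_succ, gammaCoef, hiK, h0]
      · intro I hI
        have hII : I * I = -1 := hI
        rw [hprev I hI, hx I hI, add_mul, mul_add, smul_mul_assoc, mul_add, ← mul_assoc I I, hII]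
        simp only [mul_add, mul_smul_comm, Quaternion.coe_mul_eq_smul, smul_add, neg_mul, one_mul,
          smul_neg]
        abel
    · simp only [hiK, if_false, pow_zero, one_mul]
      rw [inv_mul_sphericalDirac hJ (hzk i) hprevd hprev, hB, Finset.smul_sum]
      refine Finset.sum_congr rfl fun L _ => ?_
      by_cases h : i ∈ L <;> simp [h, hT, gammaProd_succ, gammaCoef, hiK, smul_smul]

/-- The sum `∑ x_{m,i} ∂/∂x_{m,i}` is the derivative along `Im(x_m) = β J_m`, and `(β J_m)⁻¹ = -β⁻¹
J_m`; so `β` cancels and the Cauchy-Riemann operator of the slice remains. -/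
lemma globalDbar_slicePoint {h : (Fin n → ℍ[ℝ]) → ℍ[ℝ]} {J : Fin n → ℍ[ℝ]} {z : Fin n → ℂ}
    {m : Fin n} (hJ : ∀ k, J k ∈ imagUnits) (hz : (z m).im ≠ 0) :
    globalDbar m h (slicePoint J z) =
      (1 / 2 : ℝ) • (fderiv ℝ h (slicePoint J z) (slicePoint J (Pi.single m 1)) +
        J m * fderiv ℝ h (slicePoint J z) (slicePoint J (Pi.single m Complex.I))) := by
  have hsum : ∑ i : Fin 3, imCoord (slicePoint J z m) i •
      partialAt m (unitVec i) h (slicePoint J z) =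
      fderiv ℝ h (slicePoint J z) (Pi.single m ((slicePoint J z m).im)) := by
    simp only [partialAt, ← map_smul, ← map_sum, ← Pi.single_smul']
    congr 1
    have : (slicePoint J z m).im = ∑ i : Fin 3, imCoord (slicePoint J z m) i • unitVec i := by
      ext <;> simp [Fin.sum_univ_three, imCoord, imI_unitVec, imJ_unitVec, imK_unitVec]
    rw [this]
    funext k
    by_cases hk : k = m
    · subst hk; simp
    · simp [hk]
  have hinv : (J m)⁻¹ = -J m := inv_eq_of_mul_eq_one_right (by
    rw [mul_neg, show J m * J m = -1 from hJ m, neg_neg])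
  rw [globalDbar, hsum, im_slicePoint hJ, slicePoint_single_one, slicePoint_single_I,
    Pi.single_smul', map_smul, partialAt]
  congr 1
  have : ((z m).im • J m)⁻¹ = (z m).im⁻¹ • (J m)⁻¹ := by
    refine inv_eq_of_mul_eq_one_right ?_
    have h0 : J m ≠ 0 := fun h0 => by
      have := (mem_imagUnits_iff.1 (hJ m)).2
      simp [h0] at this
    rw [smul_mul_smul_comm, mul_inv_cancel₀ hz, mul_inv_cancel₀ h0, one_smul]
  rw [this, hinv, smul_mul_smul_comm, inv_mul_cancel₀ hz, one_smul, neg_mul, sub_neg_eq_add]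

lemma isOpen_forall_im_ne_zero {D : Set (Fin n → ℂ)} (hD : IsOpen D) :
    IsOpen (D ∩ {z | ∀ k, (z k).im ≠ 0}) := by
  refine hD.inter ?_
  simp only [ofPred_forall]
  exact isOpen_iInter_of_finite fun k =>
    isOpen_ne_fun (Complex.continuous_im.comp (continuous_apply k)) continuous_const

/-- The conjugate Wirtinger operator of a slice function is the slice function induced by the
Cauchy-Riemann operator of the stem function. -/
lemma wirtingerBar_slicePoint {D : Set (Fin n → ℂ)} {F : (Fin n → ℂ) → StemSpace n}
    {f : (Fin n → ℍ[ℝ]) → ℍ[ℝ]} (hD : IsOpen D) (hΩ : IsOpen (circularization D))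
    (hF : Induces D F f) (hf : ContDiffOn ℝ n f (circularization D \ realLocus n)) (m : Fin n)
    {z : Fin n → ℂ} (hz : z ∈ D) (hzk : ∀ k, (z k).im ≠ 0) (hFd : DifferentiableAt ℝ F z)
    {J : Fin n → ℍ[ℝ]} (hJ : ∀ k, J k ∈ imagUnits) :
    wirtingerBar m f (slicePoint J z) = ∑ L, orderedProd J L * stemDbar m F z L := by
  have hV : IsOpen (circularization D \ realLocus n) := hΩ.sdiff isClosed_realLocus
  have hxV : slicePoint J z ∈ circularization D \ realLocus n :=
    ⟨slicePoint_mem_circularization hz hJ, (slicePoint_notMem_realLocus hJ).2 hzk⟩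
  have hdir : ∀ K c, fderiv ℝ (gammaIter f m.castSucc K) (slicePoint J z)
      (slicePoint J (Pi.single m c)) =
      ∑ L, gammaProd m K L z • (orderedProd J (upperPart m L) * fderiv ℝ F z (Pi.single m c) L) := by
    intro K c
    have hgd : DifferentiableAt ℝ (gammaIter f m.castSucc K) (slicePoint J z) := by
      have h1 := (contDiffOn_gammaIter hV (fun x hx => hx.2) hf m.castSucc K).contDiffAt
        (hV.mem_nhds hxV)
      refine h1.differentiableAt ?_
      have : n - m.castSucc.val ≠ 0 := by simp only [Fin.val_castSucc]; omega
      exact_mod_cast this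
    have hline : HasDerivAt (fun t : ℝ => z + t • (Pi.single m c : Fin n → ℂ)) (Pi.single m c) 0 := by
      simpa using ((hasDerivAt_id (0 : ℝ)).smul_const (Pi.single m c : Fin n → ℂ)).const_add z
    have hline0 : z + (0 : ℝ) • (Pi.single m c : Fin n → ℂ) = z := by simp
    have e1 : HasDerivAt (fun t : ℝ => gammaIter f m.castSucc K
        (sliceMap J (z + t • (Pi.single m c : Fin n → ℂ))))
        (fderiv ℝ (gammaIter f m.castSucc K) (slicePoint J z) (slicePoint J (Pi.single m c))) 0 := by
      have h1 := (sliceMap J).hasFDerivAt.comp_hasDerivAt (0 : ℝ) hline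
      have h2 := hgd.hasFDerivAt
      rw [← sliceMap_apply, ← sliceMap_apply]
      rw [← sliceMap_apply] at h2
      nth_rewrite 2 [← hline0] at h2
      exact h2.comp_hasDerivAt (0 : ℝ) h1
    have e2 : HasDerivAt (fun t : ℝ => ∑ L, gammaProd m K L z • (orderedProd J (upperPart m L) *
        F (z + t • (Pi.single m c : Fin n → ℂ)) L))
        (∑ L, gammaProd m K L z • (orderedProd J (upperPart m L) *
          fderiv ℝ F z (Pi.single m c) L)) 0 := by
      have h2 := hFd.hasFDerivAt
      nth_rewrite 2 [← hline0] at h2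
      have h3 := h2.comp_hasDerivAt (0 : ℝ) hline
      rw [hasDerivAt_pi] at h3
      exact HasDerivAt.fun_sum fun L _ => ((h3 L).const_mul _).const_smul (gammaProd m K L z)
    -- Both sides are derivatives at `0` of the same function of `t`: along the line only `z m`
    -- moves, and `gammaProd m` depends only on the earlier coordinates.
    refine e1.unique (e2.congr_of_eventuallyEq ?_)
    have hnear : ∀ᶠ t : ℝ in 𝓝 0, z + t • (Pi.single m c : Fin n → ℂ) ∈
        D ∩ {z | ∀ k, (z k).im ≠ 0} := by
      have := hline.continuousAt
      refine this.eventually_mem ((isOpen_forall_im_ne_zero hD).mem_nhds ?_)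
      rw [hline0]
      exact ⟨hz, hzk⟩
    filter_upwards [hnear] with t ht
    rw [sliceMap_apply, gammaIter_slicePoint hΩ hF hf m.castSucc K _ ht.1 ht.2 J hJ]
    refine Finset.sum_congr rfl fun L _ => ?_
    rw [Fin.val_castSucc, gammaProd_congr (K' := K) (L' := L) (z' := z) (fun _ _ => Iff.rfl)
      (fun _ _ => Iff.rfl) fun k hk => ?_]
    have : k ≠ m := fun h => by simp [h] at hk
    simp [this]
  have hglob : ∀ K, globalDbar m (gammaIter f m.castSucc K) (slicePoint J z) =
      ∑ L, gammaProd m K L z • (orderedProd J (upperPart m L) * stemDbar m F z L) := by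
    intro K
    rw [globalDbar_slicePoint hJ (hzk m), hdir, hdir]
    -- Since `J_m` is the leftmost possible factor of the upper part, adding `m` to `L` multiplies
    -- the weight by `J_m` on the left.
    have := sum_mul_complexStructure m (J := J m) (hJ m)
      (fun L => gammaProd m K L z • orderedProd J (upperPart m L)) (fun L hL => by
        rw [orderedProd_upperPart, orderedProd_upperPart J m L,
          gammaProd_congr (K' := K) (L' := L) (z' := z) (fun _ _ => Iff.rfl)
          (fun k hk => ?_) fun _ _ => rfl, mul_smul_comm]
        · simp only [Finset.mem_insert_self, if_true, hL, if_false, one_mul]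
          congr 3
          ext k
          simp only [upperPart, Finset.mem_filter, Finset.mem_insert]
          constructor
          · rintro ⟨rfl | h, h2⟩
            · omega
            · exact ⟨h, h2⟩
          · exact fun h => ⟨Or.inr h.1, h.2⟩
        · have : k ≠ m := fun h => by simp [h] at hk
          simp [this]) (fderiv ℝ F z (Pi.single m Complex.I))
    simp only [smul_mul_assoc] at this
    rw [← this, ← Finset.sum_add_distrib, Finset.smul_sum]
    refine Finset.sum_congr rfl fun L _ => ?_
    simp only [stemDbar, Pi.smul_apply, Pi.add_apply, mul_smul_comm, mul_add, smul_add]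
    rw [smul_comm, smul_comm (1 / 2 : ℝ)]
  have hIio : (Finset.Iio m) = lowerPart m Finset.univ := by
    ext k; simp [lowerPart]
  rw [wirtingerBar, hIio]
  simp only [hglob, Finset.mul_sum]
  rw [Finset.sum_comm]
  refine Finset.sum_congr rfl fun L _ => ?_
  rw [← orderedProd_lowerPart_mul_upperPart J m L,
    ← sum_orderedProd_mul_gammaProd hzk hJ L m m.2.le, Finset.sum_mul, Finset.sum_mul]
  refine Finset.sum_congr rfl fun K _ => ?_
  simp only [mul_smul_comm, smul_mul_assoc, mul_assoc]

end

section


open Set Filter Topology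

variable {n : ℕ}

/-! ### Conjugations and the restriction of a slice function to one slice -/

/-- The coordinates of `z` with index in `S` are conjugated. -/
def conjOn (S : Finset (Fin n)) (z : Fin n → ℂ) : Fin n → ℂ :=
  fun k => if k ∈ S then starRingEnd ℂ (z k) else z k

lemma conjOn_empty (z : Fin n → ℂ) : conjOn ∅ z = z := by funext k; simp [conjOn]

lemma conjOn_insert {S : Finset (Fin n)} {h : Fin n} (hS : h ∉ S) (z : Fin n → ℂ) :
    conjOn (insert h S) z = conjAt h (conjOn S z) := by
  funext k
  by_cases hk : k = h
  · subst hk; simp [conjOn, conjAt, hS]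
  · simp [conjOn, conjAt, hk]

lemma conjSign_insert {S : Finset (Fin n)} {h : Fin n} (hS : h ∉ S) (K : Finset (Fin n)) :
    conjSign (insert h S) K = (if h ∈ K then -1 else 1) * conjSign S K := by
  have key : ∀ S : Finset (Fin n), conjSign S K = ∏ k ∈ S, if k ∈ K then (-1 : ℝ) else 1 := by
    intro S
    rw [← conjSign_eq_prod, conjSign, conjSign]
    exact Finset.prod_congr rfl fun k _ => by simp [and_comm]
  rw [key, key, Finset.prod_insert hS]

lemma conjOn_mem {D : Set (Fin n → ℂ)} (hD : ConjInvariant D) (S : Finset (Fin n))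
    {z : Fin n → ℂ} (hz : z ∈ D) : conjOn S z ∈ D := by
  induction S using Finset.induction_on with
  | empty => simpa [conjOn_empty] using hz
  | insert h S hS ih => rw [conjOn_insert hS]; exact hD _ ih h

lemma stem_conjOn {D : Set (Fin n → ℂ)} (hD : ConjInvariant D) {F : (Fin n → ℂ) → StemSpace n}
    (hF : IsStem D F) (S K : Finset (Fin n)) {z : Fin n → ℂ} (hz : z ∈ D) :
    F (conjOn S z) K = conjSign S K • F z K := by
  induction S using Finset.induction_on with
  | empty => simp [conjOn_empty, conjSign]
  | insert h S hS ih =>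
    rw [conjOn_insert hS, hF _ (conjOn_mem hD S hz), ih, conjSign_insert hS]
    split_ifs <;> simp

/-- The constant family of imaginary units `i`. -/
def unitI : Fin n → ℍ[ℝ] := fun _ => unitVec 0

lemma unitI_mem (k : Fin n) : (unitI k : ℍ[ℝ]) ∈ imagUnits := unitVec_zero_mul_self

lemma unitVec_zero_ne_zero : unitVec 0 ≠ 0 := fun h => by
  have := unitVec_zero_mul_self
  simp [h] at this

lemma orderedProd_unitI (K : Finset (Fin n)) :
    orderedProd (unitI : Fin n → ℍ[ℝ]) K = unitVec 0 ^ K.card := by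
  have := orderedProd_smul_const (fun _ : Fin n => (1 : ℝ)) (unitVec 0) K
  simp only [one_smul, Finset.prod_const_one] at this
  exact this

/-- Conjugating coordinates stays in one slice and multiplies `F_K` by characters, so inversion
recovers the whole stem function from that slice. -/
lemma stem_eq_sum_conjOn {D : Set (Fin n → ℂ)} (hD : ConjInvariant D)
    {F : (Fin n → ℂ) → StemSpace n} (hF : IsStem D F) {f : (Fin n → ℍ[ℝ]) → ℍ[ℝ]}
    (hf : Induces D F f) (L : Finset (Fin n)) {z : Fin n → ℂ} (hz : z ∈ D) :
    F z L = (unitVec 0 ^ L.card)⁻¹ *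
      (((2 : ℝ) ^ n)⁻¹ • ∑ S, conjSign S L • f (slicePoint unitI (conjOn S z))) := by
  have h1 : ∀ S, f (slicePoint unitI (conjOn S z)) =
      ∑ K : Finset (Fin n), conjSign S K • (unitVec 0 ^ K.card * F z K) := by
    intro S
    rw [hf _ (conjOn_mem hD S hz) _ unitI_mem]
    refine Finset.sum_congr rfl fun K _ => ?_
    rw [orderedProd_unitI, stem_conjOn hD hF S K hz, mul_smul_comm]
  simp only [h1]
  rw [sum_conjSign_smul, smul_smul, inv_mul_cancel₀ (by positivity), one_smul,
    inv_mul_cancel_left₀ (pow_ne_zero _ unitVec_zero_ne_zero)]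

lemma contDiff_conjOn (S : Finset (Fin n)) {k : WithTop ℕ∞} :
    ContDiff ℝ k (conjOn S : (Fin n → ℂ) → Fin n → ℂ) := by
  rw [contDiff_pi]
  intro j
  by_cases hj : j ∈ S
  · simp only [conjOn, hj, if_true]
    exact Complex.conjCLE.contDiff.comp (contDiff_apply ℝ ℂ j)
  · simp only [conjOn, hj, if_false]
    exact contDiff_apply ℝ ℂ j

/-- A stem function is as regular as the restriction to a slice of the function it induces. -/
lemma contDiffOn_stem {D W : Set (Fin n → ℂ)} (hD : ConjInvariant D) (hWD : W ⊆ D)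
    (hW : ∀ S, MapsTo (conjOn S) W W) {F : (Fin n → ℂ) → StemSpace n} (hF : IsStem D F)
    {f : (Fin n → ℍ[ℝ]) → ℍ[ℝ]} (hf : Induces D F f) {k : WithTop ℕ∞}
    (hg : ContDiffOn ℝ k (fun z => f (slicePoint unitI z)) W) : ContDiffOn ℝ k F W := by
  rw [contDiffOn_pi]
  intro L
  refine ContDiffOn.congr ?_ fun z hz => stem_eq_sum_conjOn hD hF hf L (hWD hz)
  refine contDiffOn_const.mul (ContDiffOn.const_smul _ (ContDiffOn.sum fun S _ =>
    ContDiffOn.const_smul _ ?_))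
  exact hg.comp (contDiff_conjOn S).contDiffOn (hW S)

/-- Two representations of one point have equal real parts and imaginary parts equal up to sign, so
they differ by conjugations, under which `D` is invariant. This transfers openness from `Ω` to `D`.
-/
lemma preimage_circularization {D : Set (Fin n → ℂ)} (hD : ConjInvariant D) :
    sliceMap unitI ⁻¹' circularization D = D := by
  ext z
  rw [mem_preimage, sliceMap_apply]
  refine ⟨?_, fun hz => slicePoint_mem_circularization hz unitI_mem⟩
  rintro ⟨w, hw, J, hJ, h⟩
  have hcoord : ∀ k, z k = w k ∨ z k = starRingEnd ℂ (w k) := by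
    intro k
    have hk := congrFun h k
    have him := im_slicePoint unitI_mem z k
    rw [hk, im_slicePoint hJ w k] at him
    rw [slicePoint_apply, slicePoint_apply] at hk
    have hre := congrArg (·.re) hk
    simp only [Quaternion.re_add, Quaternion.re_coe, Quaternion.re_smul,
      (mem_imagUnits_iff.1 (unitI_mem k)).1, (mem_imagUnits_iff.1 (hJ k)).1, smul_zero,
      add_zero] at hre
    have hsq := congrArg (fun q : ℍ[ℝ] => (q * q).re) him
    simp only [smul_mul_smul_comm, show J k * J k = -1 from hJ k,
      show (unitI k : ℍ[ℝ]) * unitI k = -1 from unitI_mem k, Quaternion.re_smul,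
      Quaternion.re_neg, Quaternion.re_one, smul_eq_mul, mul_neg, mul_one, neg_inj] at hsq
    rcases mul_self_eq_mul_self_iff.1 hsq with h1 | h1
    · exact Or.inl (Complex.ext hre h1.symm)
    · exact Or.inr (Complex.ext (by simpa using hre) (by simp [h1]))
  have : z = conjOn (Finset.univ.filter fun k => z k ≠ w k) w := by
    funext k
    simp only [conjOn, Finset.mem_filter, Finset.mem_univ, true_and]
    split_ifs with hk
    · exact (hcoord k).resolve_left hk
    · exact not_not.1 hk
  rw [this]
  exact conjOn_mem hD _ hw

/-! ### Holomorphy of the restriction to a slice -/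

/-- The complex coordinates of `ℍ` as a left vector space over `ℝ + ℝ i`. -/
def quaternionToComplex : Fin 2 → ℍ[ℝ] →L[ℝ] ℂ :=
  ![LinearMap.toContinuousLinearMap
      { toFun := fun q => ⟨q.re, q.imI⟩
        map_add' := fun q r => by apply Complex.ext <;> simp
        map_smul' := fun c q => by apply Complex.ext <;> simp },
    LinearMap.toContinuousLinearMap
      { toFun := fun q => ⟨q.imJ, q.imK⟩
        map_add' := fun q r => by apply Complex.ext <;> simp
        map_smul' := fun c q => by apply Complex.ext <;> simp }]

lemma quaternionToComplex_unitVec_mul (a : Fin 2) (q : ℍ[ℝ]) :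
    quaternionToComplex a (unitVec 0 * q) = Complex.I * quaternionToComplex a q := by
  fin_cases a <;> apply Complex.ext <;>
    simp [quaternionToComplex, imI_unitVec, imJ_unitVec, imK_unitVec]

/-- The quaternion with given complex coordinates. -/
def complexToQuaternion : ℂ × ℂ →L[ℝ] ℍ[ℝ] :=
  LinearMap.toContinuousLinearMap
    { toFun := fun p => ⟨p.1.re, p.1.im, p.2.re, p.2.im⟩
      map_add' := fun _ _ => Quaternion.ext _ _ (Complex.add_re _ _) (Complex.add_im _ _)
        (Complex.add_re _ _) (Complex.add_im _ _)
      map_smul' := fun _ _ => Quaternion.ext _ _ (Complex.smul_re _ _) (Complex.smul_im _ _)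
        (Complex.smul_re _ _) (Complex.smul_im _ _) }

lemma complexToQuaternion_quaternionToComplex (q : ℍ[ℝ]) :
    complexToQuaternion (quaternionToComplex 0 q, quaternionToComplex 1 q) = q :=
  Quaternion.ext _ _ rfl rfl rfl rfl

/-- A continuous quaternionic function satisfying the Cauchy-Riemann equations at the points without
real coordinates is of class `C¹`. -/
lemma contDiffOn_of_cauchyRiemann {g : (Fin n → ℂ) → ℍ[ℝ]} {D : Set (Fin n → ℂ)} (hD : IsOpen D)
    (hg : ContinuousOn g D)
    (hd : ∀ z ∈ D, (∀ k, (z k).im ≠ 0) → ∀ h : Fin n, DifferentiableAt ℝ g z ∧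
      fderiv ℝ g z (Pi.single h Complex.I) = unitVec 0 * fderiv ℝ g z (Pi.single h 1)) :
    ContDiffOn ℝ 1 g D := by
  have hcomp : ∀ a, ContDiffOn ℝ 1 (fun z => quaternionToComplex a (g z)) D := by
    intro a
    refine ContDiffOn.restrict_scalars ℝ (𝕜' := ℂ) ?_
    refine contDiffOn_one_of_separately hD
      ((quaternionToComplex a).continuous.comp_continuousOn hg) fun z hz hzk h => ?_
    obtain ⟨h1, h2⟩ := hd z hz hzk h
    have hz0 : Function.update z h (z h) = z := Function.update_eq_self h z
    have hupd := hasFDerivAt_update (𝕜 := ℝ) z (i := h) (z h)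
    have hgd := h1.hasFDerivAt
    nth_rewrite 2 [← hz0] at hgd
    have hder := (quaternionToComplex a).hasFDerivAt.comp (z h) (hgd.comp (z h) hupd)
    have hsingle : ∀ c : ℂ, (ContinuousLinearMap.pi
        (Pi.single h (ContinuousLinearMap.id ℝ ℂ)) : ℂ →L[ℝ] (Fin n → ℂ)) c = Pi.single h c := by
      intro c
      funext k
      by_cases hk : k = h
      · subst hk; simp
      · simp [hk]
    -- What remains is the Cauchy-Riemann equation in one variable; left multiplication by the
    -- quaternion `i` has become multiplication by `Complex.I`.
    rw [differentiableAt_complex_iff_differentiableAt_real]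
    refine ⟨hder.differentiableAt, ?_⟩
    have hfd := hder.fderiv
    change fderiv ℝ (fun t => quaternionToComplex a (g (Function.update z h t))) (z h) = _ at hfd
    rw [hfd]
    simp only [ContinuousLinearMap.comp_apply, hsingle, h2, quaternionToComplex_unitVec_mul,
      smul_eq_mul]
  refine (complexToQuaternion.contDiff.comp_contDiffOn ((hcomp 0).prodMk (hcomp 1))).congr
    fun z _ => ?_
  simp [complexToQuaternion_quaternionToComplex]

lemma fderiv_sum_stem {D : Set (Fin n → ℂ)} (hD : IsOpen D) {F : (Fin n → ℂ) → StemSpace n}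
    {f : (Fin n → ℍ[ℝ]) → ℍ[ℝ]} (hf : Induces D F f) {z : Fin n → ℂ} (hz : z ∈ D)
    (hFd : DifferentiableAt ℝ F z) :
    DifferentiableAt ℝ (fun z => f (slicePoint unitI z)) z ∧ ∀ c,
      fderiv ℝ (fun z => f (slicePoint unitI z)) z c =
        ∑ K : Finset (Fin n), unitVec 0 ^ K.card * fderiv ℝ F z c K := by
  have hev : (fun z => f (slicePoint unitI z)) =ᶠ[𝓝 z]
      fun z => ∑ K : Finset (Fin n), unitVec 0 ^ K.card * F z K := by
    filter_upwards [hD.mem_nhds hz] with w hw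
    rw [hf w hw _ unitI_mem]
    simp only [orderedProd_unitI]
  have h1 := hasFDerivAt_pi'.1 hFd.hasFDerivAt
  have h2 := (HasFDerivAt.fun_sum fun (K : Finset (Fin n)) (_ : K ∈ Finset.univ) =>
    (h1 K).const_mul (unitVec 0 ^ K.card)).congr_of_eventuallyEq hev
  refine ⟨h2.differentiableAt, fun c => ?_⟩
  rw [h2.fderiv]
  simp

lemma continuousOn_stemDbar {D : Set (Fin n → ℂ)} (hD : IsOpen D) {F : (Fin n → ℂ) → StemSpace n}
    (hF : ContDiffOn ℝ 1 F D) (h : Fin n) : ContinuousOn (stemDbar h F) D := by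
  have hp : ∀ c, ContinuousOn (fun z => fderiv ℝ F z c) D := fun c =>
    (hF.continuousOn_fderiv_of_isOpen hD le_rfl).clm_apply continuousOn_const
  have hcs : Continuous (complexStructure h : StemSpace n → StemSpace n) := by
    refine continuous_pi fun K => ?_
    by_cases hK : h ∈ K
    · simp only [complexStructure, hK, if_true]; exact continuous_apply _
    · simp only [complexStructure, hK, if_false]; exact (continuous_apply _).neg
  exact ((hp _).add (hcs.comp_continuousOn (hp _))).const_smul (1 / 2 : ℝ)

end

end SliceSeveral

end

/-! ### The equivalence -/

open SliceSeveral in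
theorem mainTheorem1 (n : ℕ) (Ω : Set (Fin n → ℍ[ℝ])) (hΩ : IsOpen Ω)
    (hsymm : SliceSeveral.IsAxiallySymmetric Ω)
    (f : (Fin n → ℍ[ℝ]) → ℍ[ℝ]) (hf : SliceSeveral.IsSlice Ω f)
    (hcont : ContinuousOn f Ω)
    (hdiff : ContDiffOn ℝ n f (Ω \ SliceSeveral.realLocus n)) :
    SliceSeveral.IsSliceRegular Ω f ↔
      ∀ m : Fin n, ∀ x ∈ Ω \ SliceSeveral.realLocus n, SliceSeveral.wirtingerBar m f x = 0 := by
  constructor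
  · rintro ⟨D, F, hDo, -, rfl, -, hind, hF1, hF0⟩ m x ⟨⟨z, hz, J, hJ, rfl⟩, hx⟩
    rw [wirtingerBar_slicePoint hDo hΩ hind hdiff m hz ((slicePoint_notMem_realLocus hJ).1 hx)
      ((hF1.contDiffAt (hDo.mem_nhds hz)).differentiableAt one_ne_zero) hJ]
    simp [hF0 m z hz]
  · intro hW
    obtain ⟨D, F, hD, rfl, hstem, hind⟩ := hf
    have hDo : IsOpen D := by
      rw [← preimage_circularization hD]
      exact hΩ.preimage (sliceMap unitI).continuous
    set N : Set (Fin n → ℂ) := {z | ∀ k, (z k).im ≠ 0} with hN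
    have hDN : IsOpen (D ∩ N) := isOpen_forall_im_ne_zero hDo
    have hslice : (fun z => f (slicePoint unitI z)) = f ∘ sliceMap unitI :=
      funext fun z => by rw [Function.comp, sliceMap_apply]
    have hgc : ContinuousOn (fun z => f (slicePoint unitI z)) D := by
      rw [hslice]
      refine hcont.comp (sliceMap unitI).continuous.continuousOn fun z hz => ?_
      rw [sliceMap_apply]
      exact slicePoint_mem_circularization hz unitI_mem
    -- For `n = 0` the hypothesis on `f` gives only continuity, but then there is no index `m` and
    -- nothing to differentiate.
    have hFd : 1 ≤ n → ∀ z ∈ D ∩ N, DifferentiableAt ℝ F z := by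
      intro hn z hz
      refine ContDiffAt.differentiableAt (n := 1) ?_ one_ne_zero
      refine ContDiffOn.contDiffAt (s := D ∩ N) ?_ (hDN.mem_nhds hz)
      refine contDiffOn_stem hD Set.inter_subset_left (fun S w hw => ⟨conjOn_mem hD S hw.1, ?_⟩)
        hstem hind ?_
      · intro k
        have := hw.2 k
        simp only [conjOn]
        split_ifs <;> simpa using this
      · rw [hslice]
        refine (hdiff.of_le (by exact_mod_cast hn)).comp
          (sliceMap unitI).contDiff.contDiffOn fun w hw => ?_
        rw [sliceMap_apply]
        exact ⟨slicePoint_mem_circularization hw.1 unitI_mem,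
          (slicePoint_notMem_realLocus unitI_mem).2 hw.2⟩
    have hdbar : ∀ m : Fin n, ∀ z ∈ D ∩ N, stemDbar m F z = 0 := by
      intro m z hz
      refine stemSpace_eq_zero fun J hJ => ?_
      rw [← wirtingerBar_slicePoint hDo hΩ hind hdiff m hz.1 hz.2 (hFd m.pos z hz) hJ]
      exact hW m _ ⟨slicePoint_mem_circularization hz.1 hJ,
        (slicePoint_notMem_realLocus hJ).2 hz.2⟩
    have hg1 : ContDiffOn ℝ 1 (fun z => f (slicePoint unitI z)) D := by
      refine contDiffOn_of_cauchyRiemann hDo hgc fun z hz hzk h => ?_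
      obtain ⟨h1, h2⟩ := fderiv_sum_stem hDo hind hz (hFd h.pos z ⟨hz, hzk⟩)
      refine ⟨h1, ?_⟩
      have h3 : fderiv ℝ F z (Pi.single h 1) =
          -complexStructure h (fderiv ℝ F z (Pi.single h Complex.I)) := by
        have := hdbar h z ⟨hz, hzk⟩
        rw [stemDbar, smul_eq_zero] at this
        exact eq_neg_of_add_eq_zero_left (this.resolve_left (by norm_num))
      -- On the slice of the unit `i` the weights are `i^|K|`, so `𝒥_h` becomes left multiplication
      -- by `i` for every `h`.
      have h4 := sum_mul_complexStructure h unitVec_zero_mul_self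
        (fun K : Finset (Fin n) => unitVec 0 ^ K.card)
        (fun K hK => by rw [Finset.card_insert_of_notMem hK, pow_succ'])
        (fderiv ℝ F z (Pi.single h Complex.I))
      rw [h2, h2, h3]
      simp only [Pi.neg_apply, mul_neg, Finset.sum_neg_distrib]
      rw [h4, ← mul_assoc, unitVec_zero_mul_self, neg_mul, one_mul, neg_neg]
    have hF1 : ContDiffOn ℝ 1 F D :=
      contDiffOn_stem hD subset_rfl (fun S _ hw => conjOn_mem hD S hw) hstem hind hg1
    refine ⟨D, F, hDo, hD, rfl, hstem, hind, hF1, fun h z hz => ?_⟩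
    -- A nonzero value of the continuous `∂̄_h F` would persist nearby and so reach a point without
    -- real coordinates.
    by_contra hne
    have hev := ((continuousOn_stemDbar hDo hF1 h).continuousAt (hDo.mem_nhds hz)).eventually_ne hne
    obtain ⟨w, hwN, hw0, hwD⟩ := ((mem_closure_iff_frequently.1
      (dense_forall_im_ne_zero z)).and_eventually (hev.and (hDo.mem_nhds hz))).exists
    exact hw0 (hdbar h w ⟨hwD, hwN⟩)
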